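/- Let $T>1$, $m>0$, $K>0$ and $r>0$. For $N\in\mathbb N$ put $h=1/(N+1)$. For real discrete functions $v=(v_j)$ write $$(\partial_h^+v)_j=\frac{v_{j+1}-v_j}{h},\qquad (\partial_h^-v)_j=\frac{v_j-v_{j-1}}{h},\qquad (\Delta_hv)_j=\frac{v_{j+1}-2v_j+v_{j-1}}{h^2},$$ $$\|v\|_{L^2_h(0,1)}^2=h\sum_{j=1}^{N}|v_j|^2,\qquad \|v\|_{L^2_h([0,1))}^2=h\sum_{j=0}^{N}|v_j|^2,\qquad \|v\|_{L^\infty_h(0,1)}=\max_{1\le j\le N}|v_j| ,$$ and for $R_h\in H^1(0,T;L^\infty_h(0,1))$ let $$\|R_h\|_{H^1(0,T;L^\infty_h(0,1))}^2=\int_0^T\Big(\|R_h(t)\|_{L^\infty_h(0,1)}^2+\|\partial_tR_h(t)\|_{L^\infty_h(0,1)}^2\Big)\,dt,$$ where $\partial_tR_h$ is the weak derivative; $R_h(0)$ is the value at $0$ of the continuous representative. Then there is a constant $C=C(T,m,K,r)>0$, independent of $h$, such that the following holds for every $N\in\mathbb N$. Let $q_h=(q_{j,h})_{1\le j\le N}$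 satisfy $\|q_h\|_{L^\infty_h(0,1)}\le m$, let $f_h=(f_{j,h})_{1\le j\le N}\in L^2_h(0,1)$, and let $R_h\in H^1(0,T;L^\infty_h(0,1))$ satisfy $$\|R_h\|_{H^1(0,T;L^\infty_h(0,1))}\le K\qquad\text{and}\qquad |R_{j,h}(0)|\ge r\quad (1\le j\le N).$$ Let $u_h=(u_{j,h}(t))_{0\le j\le N+1}$ be the solution of $$\begin{cases}\partial_{tt}u_{j,h}-(\Delta_hu_h)_j+q_{j,h}u_{j,h}=f_{j,h}R_{j,h}(t), & t\in(0,T),\ 1\le j\le N,\\ u_{0,h}(t)=u_{N+1,h}(t)=0, & t\in(0,T),\\ u_{j,h}(0)=0,\quad \partial_tu_{j,h}(0)=0, & 1\le j\le N.\end{cases}$$ Then $$\|\partial_t(\partial_h^-u_h)_{N+1}\|_{L^2(0,T)}+\|h\,\partial_h^+\partial_{tt}u_h\|_{L^2(0,T;L^2_h([0,1)))}\le C\,\|f_h\|_{L^2_h(0,1)}$$ and $$\|f_h\|_{L^2_h(0,1)}\le C\,\|\partial_t(\partial_h^-u_h)_{N+1}\|_{L^2(0,T)}+C\,\|h\,\partial_h^+\partial_{tt}u_h\|_{L^2(0,T;L^2_h([0,1)))}.$$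 -/

import Mathlib

open Set MeasureTheory
open scoped ContDiff

namespace SemiDiscreteWave

/-- The mesh size `h = 1 / (N + 1)`.  The grid points are `x_j = j h`, `j = 0, …, N + 1`. A discrete
function is written `v : ℕ → ℝ`, with `v j` its value at `x_j`; only the indices `0, …, N + 1`
(or `1, …, N` for functions given at the interior grid points) are ever used. -/
noncomputable def mesh (N : ℕ) : ℝ := 1 / ((N : ℝ) + 1)

/-- Forward difference `(∂_h^+ v)_j = (v_{j+1} - v_j) / h`, for `0 ≤ j ≤ N`. -/
noncomputable def dPlus (N : ℕ) (v : ℕ → ℝ) (j : ℕ) : ℝ := (v (j + 1) - v j) / mesh N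

/-- Backward difference `(∂_h^- v)_j = (v_j - v_{j-1}) / h`, for `1 ≤ j ≤ N + 1`. -/
noncomputable def dMinus (N : ℕ) (v : ℕ → ℝ) (j : ℕ) : ℝ := (v j - v (j - 1)) / mesh N

/-- Discrete Laplacian `(Δ_h v)_j = (v_{j+1} - 2 v_j + v_{j-1}) / h²`, for `1 ≤ j ≤ N`. -/
noncomputable def discreteLaplacian (N : ℕ) (v : ℕ → ℝ) (j : ℕ) : ℝ :=
  (v (j + 1) - 2 * v j + v (j - 1)) / mesh N ^ 2

/-- The norm of `L²_h(0,1)`: `(h ∑_{j=1}^{N} |v_j|²)^{1/2}`. -/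
noncomputable def l2Norm (N : ℕ) (v : ℕ → ℝ) : ℝ :=
  Real.sqrt (mesh N * ∑ j ∈ Finset.Icc 1 N, |v j| ^ 2)

/-- The norm of `L²_h([0,1))`: `(h ∑_{j=0}^{N} |v_j|²)^{1/2}`. -/
noncomputable def l2NormLeft (N : ℕ) (v : ℕ → ℝ) : ℝ :=
  Real.sqrt (mesh N * ∑ j ∈ Finset.Icc 0 N, |v j| ^ 2)

/-- The norm of `L^∞_h(0,1)`: the maximum of `|v_j|`, `1 ≤ j ≤ N` (and `0` if `N = 0`). -/
noncomputable def linfNorm (N : ℕ) (v : ℕ → ℝ) : ℝ :=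
  ⨆ j : Finset.Icc 1 N, |v j|

/-- The `L²(0,T)` norm. -/
noncomputable def timeL2Norm (T : ℝ) (g : ℝ → ℝ) : ℝ :=
  Real.sqrt (∫ t in Ioo 0 T, |g t| ^ 2)

/-- Time derivative on `[0,T]` of a time-dependent discrete function, one-sided at `0` and `T`. -/
noncomputable def dt (T : ℝ) (u : ℝ → ℕ → ℝ) (t : ℝ) (j : ℕ) : ℝ :=
  derivWithin (fun s => u s j) (Icc 0 T) t

/-- `g'` is the weak derivative of `g` on `(0,T)`: `∫ g φ' = - ∫ g' φ` for every smooth function `φ`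
with compact support in `(0,T)`. -/
def IsWeakDeriv (T : ℝ) (g g' : ℝ → ℝ) : Prop :=
  ∀ φ : ℝ → ℝ, ContDiff ℝ ∞ φ → HasCompactSupport φ → tsupport φ ⊆ Ioo 0 T →
    ∫ t in Ioo 0 T, g t * deriv φ t = - ∫ t in Ioo 0 T, g' t * φ t

/-- `R` is (the continuous representative on `[0,T]` of) an element of `H¹(0,T; L^∞_h(0,1))`, and
`R'` is its weak time derivative, an element of `L²(0,T; L^∞_h(0,1))`. As `L^∞_h(0,1)` is
finite-dimensional, both can be read componentwise; that `R` is square integrable on `(0,T)` follows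
from its continuity on `[0,T]`. -/
structure IsH1 (T : ℝ) (N : ℕ) (R R' : ℝ → ℕ → ℝ) : Prop where
  continuousOn : ∀ j ∈ Finset.Icc 1 N, ContinuousOn (fun t => R t j) (Icc 0 T)
  memLp : ∀ j ∈ Finset.Icc 1 N, MemLp (fun t => R' t j) 2 (volume.restrict (Ioo 0 T))
  isWeakDeriv : ∀ j ∈ Finset.Icc 1 N, IsWeakDeriv T (fun t => R t j) (fun t => R' t j)

/-- The norm of `H¹(0,T; L^∞_h(0,1))` of `R` with weak time derivative `R'`:
`(∫_0^T ‖R(t)‖² + ‖R'(t)‖² dt)^{1/2}`, with the `L^∞_h(0,1)` norm inside. -/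
noncomputable def h1Norm (T : ℝ) (N : ℕ) (R R' : ℝ → ℕ → ℝ) : ℝ :=
  Real.sqrt (∫ t in Ioo 0 T, (linfNorm N (R t) ^ 2 + linfNorm N (R' t) ^ 2))

/-- `u` is the solution of the semi-discrete wave equation
`∂_tt u_j - (Δ_h u)_j + q_j u_j = f_j R_j(t)` for `t ∈ (0,T)`, `1 ≤ j ≤ N`, with `u_0 = u_{N+1} = 0` and
`u(0) = ∂_t u(0) = 0`.  The right-hand side is continuous in time here, so that the solution of this
system of linear ordinary differential equations is of class `C²` on `[0,T]`. -/
structure IsSolution (T : ℝ) (N : ℕ) (q f : ℕ → ℝ) (R u : ℝ → ℕ → ℝ) : Prop where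
  contDiffOn : ∀ j ∈ Finset.Icc 0 (N + 1), ContDiffOn ℝ 2 (fun t => u t j) (Icc 0 T)
  equation : ∀ t ∈ Ioo 0 T, ∀ j ∈ Finset.Icc 1 N,
    dt T (dt T u) t j - discreteLaplacian N (u t) j + q j * u t j = f j * R t j
  left_boundary : ∀ t ∈ Ioo 0 T, u t 0 = 0
  right_boundary : ∀ t ∈ Ioo 0 T, u t (N + 1) = 0
  initial_position : ∀ j ∈ Finset.Icc 1 N, u 0 j = 0
  initial_velocity : ∀ j ∈ Finset.Icc 1 N, dt T u 0 j = 0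

/-- `‖∂_t (∂_h^- u)_{N+1}‖_{L²(0,T)}`: the time derivative of the discrete flux at `x = 1`. -/
noncomputable def fluxNorm (T : ℝ) (N : ℕ) (u : ℝ → ℕ → ℝ) : ℝ :=
  timeL2Norm T (fun t => dt T (fun s => dMinus N (u s)) t (N + 1))

/-- `‖h ∂_h^+ ∂_tt u‖_{L²(0,T; L²_h([0,1)))}`. -/
noncomputable def tychonoffNorm (T : ℝ) (N : ℕ) (u : ℝ → ℕ → ℝ) : ℝ :=
  timeL2Norm T (fun t => l2NormLeft N (fun j => mesh N * dPlus N (dt T (dt T u) t) j))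

end SemiDiscreteWave

/-! Put z = ∂_t u and p = ∂_tt u. Differentiating in time moves the unknown f into the initial data:
z solves a wave equation with z(0) = 0, p(0) = f R(0) and force f R' - q z, so |R(0)| ≥ r makes the
initial energy of z dominate ‖f‖² (`le_energy_initial`). This system, `IsDifferentiatedWave`, is
understood in the absolutely continuous sense, since R' is only L² in time.

Direct inequality: an exponentially weighted energy estimate (`energy_add_integral_energy_le`)
bounds the energy by ‖f‖². The multiplier x ∂_h z then bounds the flux (`integral_flux_le`), and an
inverse inequality bounds h ∂_h^+ p (`integral_tychonoff_le`).

Inverse inequality: take the multiplier θ_j ∂_h z with θ_j = (1 + sh)^j, a discrete e^{sx}, and the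
time weight e^{-cst} with c < 1. Up to the force and the terminal energy, this controls s times the
integrated weighted energy by the flux at x = 1 and by h²|∂_h^+ p|²; the latter appears because
discrete summation by parts produces p_j p_{j+1} instead of p_j² (`momentum_deriv_le`). The initial
energy is in turn bounded by the integrated energy (`energy_estimates`). The remaining terms are
multiples of ‖f‖² in the same spatial weight: the source contributes a factor K²/s, the terminal
energy a factor e^{-s(cT-1)}. Since T > 1, c can be chosen with cT > 1, and both are absorbed for s
large (`le_of_weighted_estimates`).

This requires sh ≤ ε. On coarser meshes, h ≥ ε/s, the term h ∂_h^+ p alone controls the energy with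
a constant depending on ε/s (`massSum_le_of_large_mesh`). -/

namespace SemiDiscreteWave


/-! ### Calculus of absolutely continuous functions on [0,T] -/

/-- On `[0,T]`, `F` is a primitive of the interval integrable function `F'`; equivalently `F` is
absolutely continuous with almost everywhere derivative `F'`. -/
def HasACDeriv (T : ℝ) (F F' : ℝ → ℝ) : Prop :=
  IntervalIntegrable F' volume 0 T ∧ ∀ t ∈ Icc 0 T, F t = F 0 + ∫ s in (0 : ℝ)..t, F' s

namespace HasACDeriv

variable {T : ℝ} {F F' G G' : ℝ → ℝ}

theorem intervalIntegrable_of_mem (h : HasACDeriv T F F') {t : ℝ} (ht : t ∈ Icc 0 T) :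
    IntervalIntegrable F' volume 0 t :=
  h.1.mono_set (by rw [uIcc_of_le ht.1, uIcc_of_le (ht.1.trans ht.2)]; exact Icc_subset_Icc_right ht.2)

theorem integral_eq (h : HasACDeriv T F F') (hT : 0 ≤ T) :
    ∫ s in (0 : ℝ)..T, F' s = F T - F 0 := by
  have := h.2 T ⟨hT, le_rfl⟩
  linarith

theorem congr (h : HasACDeriv T F F') (hT : 0 ≤ T) (hF : EqOn G F (Icc 0 T))
    (hF' : EqOn G' F' (Ioo 0 T)) : HasACDeriv T G G' := by
  have hae : ∀ t ∈ Icc 0 T, ∀ᵐ s, s ∈ uIoc 0 t → F' s = G' s := by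
    intro t ht
    have : ∀ᵐ s : ℝ, s ≠ T := by simp [ae_iff, measure_singleton]
    filter_upwards [this] with s hs hst
    rw [uIoc_of_le ht.1] at hst
    exact (hF' ⟨hst.1, lt_of_le_of_ne (hst.2.trans ht.2) hs⟩).symm
  refine ⟨h.1.congr_ae ?_, fun t ht => ?_⟩
  · rw [Filter.EventuallyEq, ae_restrict_iff' measurableSet_uIoc]
    exact hae T ⟨hT, le_rfl⟩
  · rw [hF ht, hF ⟨le_rfl, hT⟩, h.2 t ht, intervalIntegral.integral_congr_ae (hae t ht)]

theorem continuousOn (h : HasACDeriv T F F') (hT : 0 ≤ T) : ContinuousOn F (Icc 0 T) := by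
  have h1 : ContinuousOn (fun t => F 0 + ∫ s in (0 : ℝ)..t, F' s) (Icc 0 T) := by
    refine continuousOn_const.add ?_
    have := intervalIntegral.continuousOn_primitive_interval (μ := volume) (f := F') (a := 0) (b := T)
      (by rw [uIcc_of_le hT, integrableOn_Icc_iff_integrableOn_Ioc]
          exact (intervalIntegrable_iff_integrableOn_Ioc_of_le hT).1 h.1)
    rwa [uIcc_of_le hT] at this
  exact h1.congr h.2

theorem add (h : HasACDeriv T F F') (g : HasACDeriv T G G') :
    HasACDeriv T (fun t => F t + G t) (fun t => F' t + G' t) := by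
  refine ⟨h.1.add g.1, fun t ht => ?_⟩
  rw [intervalIntegral.integral_add (h.intervalIntegrable_of_mem ht)
    (g.intervalIntegrable_of_mem ht)]
  beta_reduce
  rw [h.2 t ht, g.2 t ht]
  ring

theorem const_mul (h : HasACDeriv T F F') (c : ℝ) :
    HasACDeriv T (fun t => c * F t) (fun t => c * F' t) := by
  refine ⟨h.1.const_mul c, fun t ht => ?_⟩
  rw [intervalIntegral.integral_const_mul]
  beta_reduce
  rw [h.2 t ht]
  ring

theorem sub (h : HasACDeriv T F F') (g : HasACDeriv T G G') :
    HasACDeriv T (fun t => F t - G t) (fun t => F' t - G' t) := by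
  simpa [sub_eq_add_neg] using h.add (g.const_mul (-1))

theorem sum {ι : Type*} (s : Finset ι) {F F' : ι → ℝ → ℝ} (h : ∀ i ∈ s, HasACDeriv T (F i) (F' i)) :
    HasACDeriv T (fun t => ∑ i ∈ s, F i t) (fun t => ∑ i ∈ s, F' i t) := by
  classical
  induction s using Finset.induction_on with
  | empty => exact ⟨by simp, by simp⟩
  | insert a s ha ih =>
    simp only [Finset.sum_insert ha]
    exact (h a (by simp)).add (ih fun i hi => h i (by simp [hi]))

/-- The primitive is used instead of F because Lebesgue differentiation gives its `deriv` almost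
everywhere, as the product rule `mul` requires. -/
theorem absolutelyContinuousOnInterval (h : HasACDeriv T F F') {t : ℝ} (ht : t ∈ Icc 0 T) :
    AbsolutelyContinuousOnInterval (fun t => F 0 + ∫ s in (0 : ℝ)..t, F' s) 0 t := by
  have h1 := (h.intervalIntegrable_of_mem ht).absolutelyContinuousOnInterval_intervalIntegral
    (c := 0) (by simp)
  have h2 : AbsolutelyContinuousOnInterval (fun _ : ℝ => F 0) 0 t :=
    (contDiff_const (n := 1)).contDiffOn.absolutelyContinuousOnInterval
  exact h2.add h1

theorem mul (h : HasACDeriv T F F') (g : HasACDeriv T G G') (hT : 0 ≤ T) :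
    HasACDeriv T (fun t => F t * G t) (fun t => F' t * G t + F t * G' t) := by
  have hFc := h.continuousOn hT
  have hGc := g.continuousOn hT
  rw [← uIcc_of_le hT] at hFc hGc
  refine ⟨(h.1.mul_continuousOn hGc).add (g.1.continuousOn_mul hFc), fun t ht => ?_⟩
  have key := (h.absolutelyContinuousOnInterval ht).integral_deriv_mul_eq_sub
    (g.absolutelyContinuousOnInterval ht)
  simp only [intervalIntegral.integral_same, add_zero] at key
  beta_reduce
  rw [h.2 t ht, g.2 t ht, ← sub_eq_iff_eq_add', ← key]
  apply intervalIntegral.integral_congr_ae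
  filter_upwards [(h.intervalIntegrable_of_mem ht).ae_hasDerivAt_integral,
    (g.intervalIntegrable_of_mem ht).ae_hasDerivAt_integral] with s h1 h2 hs
  have hs' : s ∈ uIcc 0 t := uIoc_subset_uIcc hs
  have hsT : s ∈ Icc 0 T := by
    rw [uIcc_of_le ht.1] at hs'
    exact ⟨hs'.1, hs'.2.trans ht.2⟩
  rw [((h1 hs' 0 (by simp)).const_add (F 0)).deriv, ((h2 hs' 0 (by simp)).const_add (G 0)).deriv,
    ← h.2 s hsT, ← g.2 s hsT]

theorem of_continuousOn (hT : 0 ≤ T) (hF : ContinuousOn F (Icc 0 T))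
    (hF' : ContinuousOn F' (Icc 0 T)) (hd : ∀ t ∈ Ioo 0 T, HasDerivAt F (F' t) t) :
    HasACDeriv T F F' := by
  have hi : IntervalIntegrable F' volume 0 T := by
    apply ContinuousOn.intervalIntegrable
    rwa [uIcc_of_le hT]
  refine ⟨hi, fun t ht => ?_⟩
  rw [intervalIntegral.integral_eq_sub_of_hasDerivAt_of_le ht.1
    (hF.mono (Icc_subset_Icc_right ht.2)) (fun s hs => hd s ⟨hs.1, hs.2.trans_le ht.2⟩)
    (hi.mono_set (by rw [uIcc_of_le hT, uIcc_of_le ht.1]; exact Icc_subset_Icc_right ht.2))]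
  ring

theorem of_hasDerivAt (hT : 0 ≤ T) (hd : ∀ t, HasDerivAt F (F' t) t) (hF' : Continuous F') :
    HasACDeriv T F F' :=
  of_continuousOn hT (fun t _ => (hd t).continuousAt.continuousWithinAt) hF'.continuousOn
    fun t _ => hd t

end HasACDeriv

/-! ### Cauchy–Schwarz and the du Bois-Reymond lemma -/

/-- Cauchy–Schwarz against the constant function `1`. -/
theorem sq_integral_le {g : ℝ → ℝ} {t : ℝ} (ht : 0 ≤ t) (hg : IntervalIntegrable g volume 0 t)
    (hg2 : IntervalIntegrable (fun s => g s ^ 2) volume 0 t) :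
    (∫ s in (0 : ℝ)..t, g s) ^ 2 ≤ t * ∫ s in (0 : ℝ)..t, g s ^ 2 := by
  rcases ht.eq_or_lt with rfl | ht'
  · simp
  set c := (∫ s in (0 : ℝ)..t, g s) with hc
  -- A variance: expanding the square leaves t (t ∫ g² - c²).
  have h0 : 0 ≤ ∫ s in (0 : ℝ)..t, (t * g s - c) ^ 2 :=
    intervalIntegral.integral_nonneg ht fun s _ => sq_nonneg _
  have h1 : ∫ s in (0 : ℝ)..t, (t * g s - c) ^ 2
      = t ^ 2 * (∫ s in (0 : ℝ)..t, g s ^ 2) - 2 * t * c * c + t * c ^ 2 := by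
    have : ∀ s, (t * g s - c) ^ 2 = t ^ 2 * g s ^ 2 - 2 * t * c * g s + c ^ 2 := fun s => by ring
    simp_rw [this]
    rw [intervalIntegral.integral_add ((hg2.const_mul _).sub (hg.const_mul _)) (by simp),
      intervalIntegral.integral_sub (hg2.const_mul _) (hg.const_mul _),
      intervalIntegral.integral_const_mul, intervalIntegral.integral_const_mul,
      intervalIntegral.integral_const, smul_eq_mul, ← hc]
    ring
  have h2 : 0 ≤ t * (t * (∫ s in (0 : ℝ)..t, g s ^ 2) - c ^ 2) := by rw [h1] at h0; linarith
  linarith [nonneg_of_mul_nonneg_right h2 ht']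

/-- Smooth functions compactly supported in `(0,T)` with zero mean have primitives of the same
kind. -/
theorem exists_primitive_of_integral_eq_zero {T : ℝ} {χ : ℝ → ℝ} (hχ : ContDiff ℝ ∞ χ)
    {α β : ℝ} (hα : 0 < α) (hαβ : α < β) (hβ : β < T) (hs : ∀ x, χ x ≠ 0 → α < x ∧ x < β)
    (h0 : ∫ x, χ x = 0) :
    ∃ φ : ℝ → ℝ, ContDiff ℝ ∞ φ ∧ HasCompactSupport φ ∧ tsupport φ ⊆ Ioo 0 T ∧
      (∀ t, HasDerivAt φ (χ t) t) ∧ φ 0 = 0 ∧ φ T = 0 := by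
  have hz : ∀ x, (x ≤ α ∨ β ≤ x) → χ x = 0 := fun x hx => by
    by_contra h
    have := hs x h
    rcases hx with hx | hx <;> linarith
  have hd : ∀ t, HasDerivAt (fun t => ∫ s in α..t, χ s) (χ t) t := fun t =>
    intervalIntegral.integral_hasDerivAt_right (hχ.continuous.intervalIntegrable _ _)
      (hχ.continuous.stronglyMeasurableAtFilter _ _) hχ.continuous.continuousAt
  have hleft : ∀ t, t ≤ α → ∫ s in α..t, χ s = 0 := fun t ht => by
    rw [intervalIntegral.integral_congr (g := fun _ => 0), intervalIntegral.integral_zero]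
    intro s hs
    rw [uIcc_of_ge ht] at hs
    exact hz s (Or.inl hs.2)
  have htot : ∫ s in α..β, χ s = 0 := by
    rw [intervalIntegral.integral_of_le hαβ.le, setIntegral_eq_integral_of_forall_compl_eq_zero, h0]
    intro x hx
    by_contra h
    exact hx ⟨(hs x h).1, (hs x h).2.le⟩
  have hright : ∀ t, β ≤ t → ∫ s in α..t, χ s = 0 := fun t ht => by
    rw [← intervalIntegral.integral_add_adjacent_intervals (b := β)
      (hχ.continuous.intervalIntegrable _ _) (hχ.continuous.intervalIntegrable _ _), htot, zero_add,
      intervalIntegral.integral_congr (g := fun _ => 0), intervalIntegral.integral_zero]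
    intro s hs
    rw [uIcc_of_le ht] at hs
    exact hz s (Or.inr hs.1)
  have hsupp : tsupport (fun t => ∫ s in α..t, χ s) ⊆ Icc α β := by
    refine closure_minimal (fun t ht => ?_) isClosed_Icc
    by_contra h
    simp only [mem_Icc, not_and_or, not_le] at h
    exact ht (h.elim (fun h => hleft t h.le) fun h => hright t h.le)
  refine ⟨fun t => ∫ s in α..t, χ s, ?_, isCompact_Icc.of_isClosed_subset (isClosed_tsupport _) hsupp,
    fun t ht => ⟨hα.trans_le (hsupp ht).1, (hsupp ht).2.trans_lt hβ⟩, hd, hleft 0 hα.le,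
    hright T hβ.le⟩
  rw [contDiff_infty_iff_deriv]
  refine ⟨fun t => (hd t).differentiableAt, ?_⟩
  rw [show deriv (fun t => ∫ s in α..t, χ s) = χ from funext fun t => (hd t).deriv]
  exact hχ

/-- The lemma of du Bois-Reymond: a continuous function is the primitive of its weak derivative. -/
theorem HasACDeriv.of_isWeakDeriv {T : ℝ} (hT : 0 < T) {g g' : ℝ → ℝ}
    (hg : ContinuousOn g (Icc 0 T)) (hg' : IntervalIntegrable g' volume 0 T)
    (hw : IsWeakDeriv T g g') : HasACDeriv T g g' := by
  set G : ℝ → ℝ := fun t => ∫ s in (0 : ℝ)..t, g' s with hG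
  have hGAC : HasACDeriv T G g' := ⟨hg', fun t _ => by simp [hG]⟩
  -- The difference k has zero weak derivative; it remains to see that it is constant.
  set k : ℝ → ℝ := fun t => g t - G t with hk
  have hkc : ContinuousOn k (Icc 0 T) := hg.sub (hGAC.continuousOn hT.le)
  have hint : ∀ {ψ : ℝ → ℝ} {l : ℝ → ℝ}, ContinuousOn l (Icc 0 T) → Continuous ψ →
      IntegrableOn (fun t => l t * ψ t) (Ioo 0 T) := fun hl hψ =>
    ((hl.mul hψ.continuousOn).integrableOn_Icc).mono_set Ioo_subset_Icc_self
  have hconv : ∀ l : ℝ → ℝ, ∫ t in Ioo 0 T, l t = ∫ t in (0 : ℝ)..T, l t := fun l => by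
    rw [intervalIntegral.integral_of_le hT.le, integral_Ioc_eq_integral_Ioo]
  have hzero : ∀ φ χ : ℝ → ℝ, ContDiff ℝ ∞ φ → HasCompactSupport φ → tsupport φ ⊆ Ioo 0 T →
      (∀ t, HasDerivAt φ (χ t) t) → Continuous χ → φ 0 = 0 → φ T = 0 →
      ∫ t in Ioo 0 T, k t * χ t = 0 := by
    intro φ χ h1 h2 h3 h4 h5 h6 h7
    have e1 := hw φ h1 h2 h3
    rw [show deriv φ = χ from funext fun t => (h4 t).deriv] at e1
    have e2 := (hGAC.mul (HasACDeriv.of_hasDerivAt hT.le h4 h5) hT.le)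
    have e3 := e2.integral_eq hT.le
    have hsub : IntervalIntegrable (fun t => g' t * φ t) volume 0 T :=
      hg'.mul_continuousOn h1.continuous.continuousOn
    have hGχ : IntervalIntegrable (fun t => G t * χ t) volume 0 T :=
      (intervalIntegrable_iff_integrableOn_Ioo_of_le hT.le).2 (hint (hGAC.continuousOn hT.le) h5)
    rw [intervalIntegral.integral_add hsub hGχ, h6, h7] at e3
    have e4 : ∫ t in Ioo 0 T, k t * χ t
        = (∫ t in Ioo 0 T, g t * χ t) - ∫ t in Ioo 0 T, G t * χ t := by
      rw [← integral_sub (hint hg h5) (hint (hGAC.continuousOn hT.le) h5)]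
      simp only [hk, sub_mul]
    rw [e4, e1, hconv, hconv]
    linarith
  -- A bump of integral one: for any test function ψ, ψ - (∫ ψ) η has zero mean, hence is the
  -- derivative of a test function. Thus k can only equal its η-average κ.
  obtain ⟨η, hη1, hη2, hη3, hη4⟩ : ∃ η : ℝ → ℝ, ContDiff ℝ ∞ η ∧ HasCompactSupport η ∧
      tsupport η ⊆ Ioo 0 T ∧ ∫ x, η x = 1 := by
    let b : ContDiffBump (T / 2) := ⟨T / 8, T / 4, by positivity, by linarith⟩
    refine ⟨b.normed volume, b.contDiff_normed, b.hasCompactSupport_normed, ?_, b.integral_normed⟩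
    rw [b.tsupport_normed_eq, Real.closedBall_eq_Icc]
    intro x hx
    have : b.rOut = T / 4 := rfl
    rw [this] at hx
    exact ⟨by linarith [hx.1], by linarith [hx.2]⟩
  set κ := ∫ t in Ioo 0 T, k t * η t with hκ
  have hae : ∀ᵐ x, x ∈ Ioo 0 T → k x - κ = 0 := by
    refine isOpen_Ioo.ae_eq_zero_of_integral_contDiff_smul_eq_zero (f := fun x => k x - κ)
      (((hkc.sub continuousOn_const).integrableOn_Icc.mono_set Ioo_subset_Icc_self).locallyIntegrableOn)
      ?_
    intro ψ hψ1 hψ2 hψ3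
    set M := ∫ x, ψ x with hM
    have hψi : Integrable ψ := hψ1.continuous.integrable_of_hasCompactSupport hψ2
    have hηi : Integrable η := hη1.continuous.integrable_of_hasCompactSupport hη2
    obtain ⟨α, β, hα, hαβ, hβ, hs⟩ : ∃ α β : ℝ, 0 < α ∧ α < β ∧ β < T ∧
        ∀ x, ψ x - M * η x ≠ 0 → α < x ∧ x < β := by
      set Z := tsupport ψ ∪ tsupport η with hZ
      have hZc : IsCompact Z := hψ2.isCompact.union hη2.isCompact
      have hZT : Z ⊆ Ioo 0 T := union_subset hψ3 hη3
      have hZn : Z.Nonempty := by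
        by_contra h
        rw [not_nonempty_iff_eq_empty, hZ, union_empty_iff, tsupport_eq_empty_iff,
          tsupport_eq_empty_iff] at h
        rw [h.2] at hη4
        simp at hη4
      have ha := hZT (hZc.sInf_mem hZn)
      have hb := hZT (hZc.sSup_mem hZn)
      have hle : ∀ x ∈ Z, sInf Z ≤ x ∧ x ≤ sSup Z := fun x hx =>
        ⟨csInf_le hZc.bddBelow hx, le_csSup hZc.bddAbove hx⟩
      obtain ⟨x0, hx0⟩ := hZn
      have h00 := hle x0 hx0
      -- Going half way from the support to the ends of (0,T) makes all inequalities strict.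
      refine ⟨sInf Z / 2, (sSup Z + T) / 2, by linarith [ha.1], by linarith [ha.1, hb.2],
        by linarith [hb.2], fun x hx => ?_⟩
      have hxZ : x ∈ Z := by
        by_contra h
        rw [hZ, mem_union, not_or] at h
        rw [image_eq_zero_of_notMem_tsupport h.1, image_eq_zero_of_notMem_tsupport h.2] at hx
        simp at hx
      have := hle x hxZ
      exact ⟨by linarith [ha.1], by linarith [hb.2]⟩
    have hχ : ContDiff ℝ ∞ (fun x => ψ x - M * η x) := hψ1.sub (contDiff_const.mul hη1)
    obtain ⟨φ, h1, h2, h3, h4, h5, h6⟩ := exists_primitive_of_integral_eq_zero (T := T) hχ hα hαβ hβ hs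
      (by rw [integral_sub hψi (hηi.const_mul _), integral_const_mul, hη4]; simp [hM])
    have e := hzero φ _ h1 h2 h3 h4 hχ.continuous h5 h6
    have e1 : ∫ t in Ioo 0 T, k t * (ψ t - M * η t) = (∫ t in Ioo 0 T, k t * ψ t) - M * κ := by
      rw [hκ, ← integral_const_mul, ← integral_sub (hint hkc hψ1.continuous)
        ((hint hkc hη1.continuous).const_mul _)]
      exact integral_congr_ae (Filter.Eventually.of_forall fun t => by simp only []; ring)
    have e2 : M = ∫ t in Ioo 0 T, ψ t := by
      rw [hM, setIntegral_eq_integral_of_forall_compl_eq_zero]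
      exact fun x hx => image_eq_zero_of_notMem_tsupport fun h => hx (hψ3 h)
    have e3 : ∫ x, ψ x • (k x - κ) = ∫ t in Ioo 0 T, (k t * ψ t - κ * ψ t) := by
      rw [setIntegral_eq_integral_of_forall_compl_eq_zero]
      · exact integral_congr_ae (Filter.Eventually.of_forall fun t => by simp only [smul_eq_mul]; ring)
      · intro x hx
        rw [image_eq_zero_of_notMem_tsupport fun h => hx (hψ3 h)]
        ring
    rw [e3, integral_sub (hint hkc hψ1.continuous) (hψi.integrableOn.const_mul _),
      integral_const_mul, ← e2]
    rw [e1] at e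
    linarith
  have heq : EqOn k (fun _ => κ) (Icc 0 T) := by
    refine Measure.eqOn_Icc_of_ae_eq volume hT.ne ?_ hkc continuousOn_const
    rw [Measure.restrict_congr_set Ioo_ae_eq_Icc.symm]
    rw [Filter.EventuallyEq, ae_restrict_iff' measurableSet_Ioo]
    filter_upwards [hae] with x hx hx'
    linarith [hx hx']
  refine ⟨hg', fun t ht => ?_⟩
  have h1 := heq ht
  have h2 := heq ⟨le_rfl, hT.le⟩
  simp only [hk, hG, intervalIntegral.integral_same] at h1 h2
  linarith

/-! ### Discrete norms and summation by parts -/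

theorem mesh_pos (N : ℕ) : 0 < mesh N := by unfold mesh; positivity

theorem mesh_mul (N : ℕ) : mesh N * ((N : ℝ) + 1) = 1 := by
  unfold mesh; field_simp

/-- Weighted squared `L²_h` norm of a function on the interior grid. -/
noncomputable def massSum (N : ℕ) (θ p : ℕ → ℝ) : ℝ :=
  mesh N * ∑ i ∈ Finset.range N, θ (i + 1) * p (i + 1) ^ 2

/-- Weighted squared `L²_h` norm of the forward difference quotient. -/
noncomputable def gradSum (N : ℕ) (θ z : ℕ → ℝ) : ℝ :=
  (mesh N)⁻¹ * ∑ i ∈ Finset.range (N + 1), θ i * (z (i + 1) - z i) ^ 2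

/-- The weighted energy of the position `z` and the velocity `p`. -/
noncomputable def energy (N : ℕ) (θ z p : ℕ → ℝ) : ℝ := (massSum N θ p + gradSum N θ z) / 2

/-- The discrete multiplier functional `∑ θ p ∂_h z`, with a centered difference. -/
noncomputable def momentum (N : ℕ) (θ z p : ℕ → ℝ) : ℝ :=
  ∑ i ∈ Finset.range N, θ (i + 1) * p (i + 1) * ((z (i + 2) - z i) / 2)

theorem massSum_nonneg {N : ℕ} {θ : ℕ → ℝ} (hθ : ∀ i, 0 ≤ θ i) (p : ℕ → ℝ) : 0 ≤ massSum N θ p :=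
  mul_nonneg (mesh_pos N).le (Finset.sum_nonneg fun _ _ => mul_nonneg (hθ _) (sq_nonneg _))

theorem gradSum_nonneg {N : ℕ} {θ : ℕ → ℝ} (hθ : ∀ i, 0 ≤ θ i) (z : ℕ → ℝ) : 0 ≤ gradSum N θ z :=
  mul_nonneg (inv_nonneg.2 (mesh_pos N).le)
    (Finset.sum_nonneg fun _ _ => mul_nonneg (hθ _) (sq_nonneg _))

theorem energy_nonneg {N : ℕ} {θ : ℕ → ℝ} (hθ : ∀ i, 0 ≤ θ i) (z p : ℕ → ℝ) :
    0 ≤ energy N θ z p := by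
  unfold energy
  linarith [massSum_nonneg (N := N) hθ p, gradSum_nonneg (N := N) hθ z]

/-- Abel summation. With d_i = z_{i+1} - z_i it turns the Laplacian times the centered difference
into boundary fluxes minus a weighted gradient. -/
theorem sum_mul_sq_sub_sq (θ d : ℕ → ℝ) (N : ℕ) :
    ∑ i ∈ Finset.range N, θ (i + 1) * (d (i + 1) ^ 2 - d i ^ 2)
      = θ (N + 1) * d N ^ 2 - θ 0 * d 0 ^ 2
        - ∑ i ∈ Finset.range (N + 1), (θ (i + 1) - θ i) * d i ^ 2 := by
  induction N with
  | zero => simp; ring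
  | succ n ih => rw [Finset.sum_range_succ, ih, Finset.sum_range_succ _ (n + 1)]; ring

theorem sum_mul_mul_sub (θ p : ℕ → ℝ) (N : ℕ) :
    ∑ i ∈ Finset.range N, θ (i + 1) * p (i + 1) * (p (i + 2) - p i)
      = θ (N + 1) * p N * p (N + 1) - θ 0 * p 0 * p 1
        - ∑ i ∈ Finset.range (N + 1), (θ (i + 1) - θ i) * (p i * p (i + 1)) := by
  induction N with
  | zero => simp; ring
  | succ n ih => rw [Finset.sum_range_succ, ih, Finset.sum_range_succ _ (n + 1)]; ring

theorem sum_mul_sub_eq (θ d p : ℕ → ℝ) (N : ℕ) :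
    ∑ i ∈ Finset.range (N + 1), θ i * d i * (p (i + 1) - p i)
      = θ N * d N * p (N + 1) - θ 0 * d 0 * p 0
        - ∑ i ∈ Finset.range N, p (i + 1) * (θ (i + 1) * d (i + 1) - θ i * d i) := by
  induction N with
  | zero => simp; ring
  | succ n ih => rw [Finset.sum_range_succ, ih, Finset.sum_range_succ _ n]; ring

/-! ### The differentiated system: energy and multiplier identities, force estimates -/

/-- The force `f R' - q z` in the equation satisfied by `z = ∂_t u`. -/
def force (q f : ℕ → ℝ) (R' z : ℝ → ℕ → ℝ) (t : ℝ) (j : ℕ) : ℝ := f j * R' t j - q j * z t j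

/-- The system satisfied by the first and second time derivatives `z`, `p` of the solution of the
semi-discrete wave equation. -/
structure IsDifferentiatedWave (T m K : ℝ) (N : ℕ) (q f R₀ : ℕ → ℝ) (R' z p : ℝ → ℕ → ℝ) : Prop where
  time_pos : 0 < T
  hasACDeriv_position : ∀ j ≤ N + 1, HasACDeriv T (fun t => z t j) (fun t => p t j)
  hasACDeriv_velocity : ∀ i < N, HasACDeriv T (fun t => p t (i + 1))
    (fun t => discreteLaplacian N (z t) (i + 1) + force q f R' z t (i + 1))
  position_left : ∀ t ∈ Icc 0 T, z t 0 = 0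
  position_right : ∀ t ∈ Icc 0 T, z t (N + 1) = 0
  velocity_left : ∀ t ∈ Icc 0 T, p t 0 = 0
  velocity_right : ∀ t ∈ Icc 0 T, p t (N + 1) = 0
  initial_position : ∀ j ≤ N + 1, z 0 j = 0
  initial_velocity : ∀ i < N, p 0 (i + 1) = f (i + 1) * R₀ (i + 1)
  potential_le : ∀ i < N, |q (i + 1)| ≤ m
  source_integrable : ∀ i < N, IntervalIntegrable (fun t => R' t (i + 1)) volume 0 T
  source_sq_integrable : ∀ i < N, IntervalIntegrable (fun t => R' t (i + 1) ^ 2) volume 0 T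
  source_le : ∀ i < N, ∫ t in (0 : ℝ)..T, R' t (i + 1) ^ 2 ≤ K ^ 2

namespace IsDifferentiatedWave

variable {T m K : ℝ} {N : ℕ} {q f R₀ : ℕ → ℝ} {R' z p : ℝ → ℕ → ℝ}
  (W : IsDifferentiatedWave T m K N q f R₀ R' z p)
include W

theorem continuousOn_position {j : ℕ} (hj : j ≤ N + 1) :
    ContinuousOn (fun t => z t j) (Icc 0 T) :=
  (W.hasACDeriv_position j hj).continuousOn W.time_pos.le

theorem continuousOn_velocity {j : ℕ} (hj : j ≤ N + 1) :
    ContinuousOn (fun t => p t j) (Icc 0 T) := by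
  rcases Nat.eq_zero_or_pos j with rfl | h0
  · exact continuousOn_const.congr W.velocity_left
  · obtain ⟨i, rfl⟩ := Nat.exists_eq_add_of_le' h0
    rcases Nat.lt_or_ge i N with h | h
    · exact (W.hasACDeriv_velocity i h).continuousOn W.time_pos.le
    · obtain rfl : i = N := by omega
      exact continuousOn_const.congr W.velocity_right

theorem continuousOn_massSum (θ : ℕ → ℝ) : ContinuousOn (fun t => massSum N θ (p t)) (Icc 0 T) := by
  refine continuousOn_const.mul (continuousOn_finsetSum _ fun i hi => continuousOn_const.mul ?_)
  exact (W.continuousOn_velocity (by have := Finset.mem_range.1 hi; omega)).pow 2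

theorem continuousOn_gradSum (θ : ℕ → ℝ) : ContinuousOn (fun t => gradSum N θ (z t)) (Icc 0 T) := by
  refine continuousOn_const.mul (continuousOn_finsetSum _ fun i hi => continuousOn_const.mul ?_)
  have := Finset.mem_range.1 hi
  exact ((W.continuousOn_position (by omega)).sub (W.continuousOn_position (by omega))).pow 2

theorem continuousOn_gradSum_velocity (θ : ℕ → ℝ) :
    ContinuousOn (fun t => gradSum N θ (p t)) (Icc 0 T) := by
  refine continuousOn_const.mul (continuousOn_finsetSum _ fun i hi => continuousOn_const.mul ?_)
  have := Finset.mem_range.1 hi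
  exact ((W.continuousOn_velocity (by omega)).sub (W.continuousOn_velocity (by omega))).pow 2

/-- Summation by parts cancels the Laplacian against the derivative of the gradient part. The
velocity vanishes at both ends, so only the work of the force and a commutator with the increments
of θ survive. -/
theorem hasACDeriv_energy (θ : ℕ → ℝ) :
    HasACDeriv T (fun t => energy N θ (z t) (p t)) (fun t =>
      mesh N * ∑ i ∈ Finset.range N, θ (i + 1) * p t (i + 1) * force q f R' z t (i + 1)
      - (mesh N)⁻¹ * ∑ i ∈ Finset.range N,
          (θ (i + 1) - θ i) * (p t (i + 1) * (z t (i + 1) - z t i))) := by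
  have h0 := W.time_pos.le
  have hh := (mesh_pos N).ne'
  have hM := (HasACDeriv.sum (Finset.range N) fun i hi =>
    (((W.hasACDeriv_velocity i (Finset.mem_range.1 hi)).mul
      (W.hasACDeriv_velocity i (Finset.mem_range.1 hi)) h0).const_mul (θ (i + 1)))).const_mul (mesh N)
  have hd : ∀ i ∈ Finset.range (N + 1), HasACDeriv T (fun t => z t (i + 1) - z t i)
      (fun t => p t (i + 1) - p t i) := fun i hi => by
    have := Finset.mem_range.1 hi
    exact (W.hasACDeriv_position (i + 1) (by omega)).sub (W.hasACDeriv_position i (by omega))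
  have hG := (HasACDeriv.sum (Finset.range (N + 1)) fun i hi =>
    (((hd i hi).mul (hd i hi) h0).const_mul (θ i))).const_mul (mesh N)⁻¹
  refine ((hM.add hG).const_mul (1 / 2)).congr h0 (fun t _ => ?_) (fun t ht => ?_)
  · simp only [energy, massSum, gradSum, sq]; ring
  · have hp0 := W.velocity_left t (Ioo_subset_Icc_self ht)
    have hpN := W.velocity_right t (Ioo_subset_Icc_self ht)
    have key := sum_mul_sub_eq θ (fun i => z t (i + 1) - z t i) (p t) N
    rw [hp0, hpN] at key
    have e1 : ∑ i ∈ Finset.range (N + 1), θ i * ((p t (i + 1) - p t i) * (z t (i + 1) - z t i)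
          + (z t (i + 1) - z t i) * (p t (i + 1) - p t i))
        = 2 * ∑ i ∈ Finset.range (N + 1), θ i * (z t (i + 1) - z t i) * (p t (i + 1) - p t i) := by
      rw [Finset.mul_sum]; exact Finset.sum_congr rfl fun i _ => by ring
    beta_reduce
    rw [e1, key]
    simp only [mul_zero, sub_zero, zero_sub, Finset.mul_sum, ← Finset.sum_neg_distrib]
    rw [← Finset.sum_add_distrib, ← Finset.sum_sub_distrib, Finset.mul_sum]
    refine Finset.sum_congr rfl fun i _ => ?_
    simp only [discreteLaplacian, Nat.add_sub_cancel]
    field_simp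
    ring

/-- The centered difference makes both products telescope: (d_{i+1} - d_i)(d_{i+1} + d_i) is a
difference of squares, and p_{i+1}(p_{i+2} - p_i) is a difference of the products p_i p_{i+1}. -/
theorem hasACDeriv_momentum (θ : ℕ → ℝ) :
    HasACDeriv T (fun t => momentum N θ (z t) (p t)) (fun t =>
      ∑ i ∈ Finset.range N, θ (i + 1) * force q f R' z t (i + 1) * ((z t (i + 2) - z t i) / 2)
      + (θ (N + 1) * (z t (N + 1) - z t N) ^ 2 - θ 0 * (z t 1 - z t 0) ^ 2
        - ∑ i ∈ Finset.range (N + 1), (θ (i + 1) - θ i) * (z t (i + 1) - z t i) ^ 2)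
          / (2 * mesh N ^ 2)
      - (∑ i ∈ Finset.range (N + 1), (θ (i + 1) - θ i) * (p t i * p t (i + 1))) / 2) := by
  have h0 := W.time_pos.le
  have hh := (mesh_pos N).ne'
  have hX := HasACDeriv.sum (Finset.range N) fun i hi =>
    ((W.hasACDeriv_velocity i (Finset.mem_range.1 hi)).mul
      ((W.hasACDeriv_position (i + 2) (by have := Finset.mem_range.1 hi; omega)).sub
        (W.hasACDeriv_position i (by have := Finset.mem_range.1 hi; omega))) h0).const_mul
      (θ (i + 1) / 2)
  refine hX.congr h0 (fun t _ => ?_) (fun t ht => ?_)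
  · exact Finset.sum_congr rfl fun i _ => by ring
  · have hp0 := W.velocity_left t (Ioo_subset_Icc_self ht)
    have hpN := W.velocity_right t (Ioo_subset_Icc_self ht)
    have k1 := sum_mul_sq_sub_sq θ (fun i => z t (i + 1) - z t i) N
    have k2 := sum_mul_mul_sub θ (p t) N
    rw [hp0, hpN] at k2
    simp only [mul_zero, zero_mul, sub_zero, zero_sub] at k2
    beta_reduce at k1 ⊢
    rw [zero_add] at k1
    rw [← k1, sub_eq_add_neg, ← neg_div, ← k2, Finset.sum_div,
      Finset.sum_div, ← Finset.sum_add_distrib, ← Finset.sum_add_distrib]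
    refine Finset.sum_congr rfl fun i _ => ?_
    simp only [discreteLaplacian, Nat.add_sub_cancel]
    field_simp
    ring

theorem force_sq_integrable {i : ℕ} (hi : i < N) :
    IntervalIntegrable (fun t => force q f R' z t (i + 1) ^ 2) volume 0 T := by
  have hz := W.continuousOn_position (j := i + 1) (by omega)
  rw [← uIcc_of_le W.time_pos.le] at hz
  have e : (fun t => force q f R' z t (i + 1) ^ 2) = fun t =>
      f (i + 1) ^ 2 * R' t (i + 1) ^ 2 - 2 * f (i + 1) * q (i + 1) * (R' t (i + 1) * z t (i + 1))
        + q (i + 1) ^ 2 * z t (i + 1) ^ 2 := by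
    funext t; simp only [force]; ring
  rw [e]
  exact (((W.source_sq_integrable i hi).const_mul _).sub
    (((W.source_integrable i hi).mul_continuousOn hz).const_mul _)).add
    ((hz.pow 2).intervalIntegrable.const_mul _)

theorem massSum_force_integrable (θ : ℕ → ℝ) :
    IntervalIntegrable (fun t => massSum N θ (force q f R' z t)) volume 0 T := by
  unfold massSum
  refine IntervalIntegrable.const_mul ?_ _
  have := IntervalIntegrable.sum (μ := volume) (a := 0) (b := T) (Finset.range N)
    (f := fun i t => θ (i + 1) * force q f R' z t (i + 1) ^ 2)
    (fun i hi => (W.force_sq_integrable (Finset.mem_range.1 hi)).const_mul _)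
  simpa only [Finset.sum_fn] using this

/-- Decay of the time weight turns `z = ∫ p` into a weighted Poincaré inequality in time. -/
theorem integral_weight_mul_position_sq_le {lam : ℝ} (hlam : 0 ≤ lam) {j : ℕ} (hj : j ≤ N + 1) :
    ∫ t in (0 : ℝ)..T, Real.exp (-lam * t) * z t j ^ 2
      ≤ T ^ 2 * ∫ t in (0 : ℝ)..T, Real.exp (-lam * t) * p t j ^ 2 := by
  have h0 := W.time_pos.le
  have hzc := W.continuousOn_position hj
  have hpc := W.continuousOn_velocity hj
  have hw : ContinuousOn (fun t => Real.exp (-lam * t)) (Icc 0 T) := by fun_prop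
  have hwp : IntervalIntegrable (fun t => Real.exp (-lam * t) * p t j ^ 2) volume 0 T :=
    ContinuousOn.intervalIntegrable (by rw [uIcc_of_le h0]; exact hw.mul (hpc.pow 2))
  have hwz : IntervalIntegrable (fun t => Real.exp (-lam * t) * z t j ^ 2) volume 0 T :=
    ContinuousOn.intervalIntegrable (by rw [uIcc_of_le h0]; exact hw.mul (hzc.pow 2))
  have hpt : ∀ t ∈ Icc 0 T, Real.exp (-lam * t) * z t j ^ 2
      ≤ T * ∫ s in (0 : ℝ)..T, Real.exp (-lam * s) * p s j ^ 2 := by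
    intro t ht
    have hsub : uIcc 0 t ⊆ uIcc 0 T := by
      rw [uIcc_of_le h0, uIcc_of_le ht.1]; exact Icc_subset_Icc_right ht.2
    have hpi : IntervalIntegrable (fun s => p s j ^ 2) volume 0 t :=
      ContinuousOn.intervalIntegrable ((hpc.pow 2).mono (by rwa [uIcc_of_le h0] at hsub))
    have e1 := (W.hasACDeriv_position j hj).2 t ht
    beta_reduce at e1
    rw [W.initial_position j hj, zero_add] at e1
    have e2 : z t j ^ 2 ≤ t * ∫ s in (0 : ℝ)..t, p s j ^ 2 := by
      rw [e1]
      exact sq_integral_le ht.1 ((W.hasACDeriv_position j hj).intervalIntegrable_of_mem ht) hpi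
    -- The weight decreases, so its value at t may be replaced by its value at each earlier s.
    have e3 : Real.exp (-lam * t) * ∫ s in (0 : ℝ)..t, p s j ^ 2
        ≤ ∫ s in (0 : ℝ)..T, Real.exp (-lam * s) * p s j ^ 2 := by
      rw [← intervalIntegral.integral_const_mul]
      calc _ ≤ ∫ s in (0 : ℝ)..t, Real.exp (-lam * s) * p s j ^ 2 := by
            refine intervalIntegral.integral_mono_on ht.1 (hpi.const_mul _) (hwp.mono_set hsub) ?_
            intro s hs
            refine mul_le_mul_of_nonneg_right (Real.exp_le_exp.2 ?_) (sq_nonneg _)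
            nlinarith [hs.2]
        _ ≤ _ := intervalIntegral.integral_mono_interval le_rfl ht.1 ht.2
            (Filter.Eventually.of_forall fun s => by positivity) hwp
    have e4 : 0 ≤ ∫ s in (0 : ℝ)..T, Real.exp (-lam * s) * p s j ^ 2 :=
      intervalIntegral.integral_nonneg h0 fun s _ => by positivity
    calc _ ≤ Real.exp (-lam * t) * (t * ∫ s in (0 : ℝ)..t, p s j ^ 2) := by gcongr
      _ = t * (Real.exp (-lam * t) * ∫ s in (0 : ℝ)..t, p s j ^ 2) := by ring
      _ ≤ t * ∫ s in (0 : ℝ)..T, Real.exp (-lam * s) * p s j ^ 2 :=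
        mul_le_mul_of_nonneg_left e3 ht.1
      _ ≤ _ := mul_le_mul_of_nonneg_right ht.2 e4
  calc _ ≤ ∫ _ in (0 : ℝ)..T, T * ∫ s in (0 : ℝ)..T, Real.exp (-lam * s) * p s j ^ 2 :=
        intervalIntegral.integral_mono_on h0 hwz (by simp) hpt
    _ = _ := by simp; ring

/-- The time weight is dropped on the f R' part, for which only an L² bound in time is known, but
kept on the potential part, which must later be absorbed by the weighted energy. -/
theorem integral_weight_mul_force_sq_le {lam : ℝ} (hlam : 0 ≤ lam) {i : ℕ} (hi : i < N) :
    ∫ t in (0 : ℝ)..T, Real.exp (-lam * t) * force q f R' z t (i + 1) ^ 2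
      ≤ 2 * K ^ 2 * f (i + 1) ^ 2
        + 2 * m ^ 2 * T ^ 2 * ∫ t in (0 : ℝ)..T, Real.exp (-lam * t) * p t (i + 1) ^ 2 := by
  have h0 := W.time_pos.le
  have hw : ContinuousOn (fun t => Real.exp (-lam * t)) (uIcc 0 T) := by fun_prop
  have hzc := W.continuousOn_position (j := i + 1) (by omega)
  have hwz : IntervalIntegrable (fun t => Real.exp (-lam * t) * z t (i + 1) ^ 2) volume 0 T :=
    ContinuousOn.intervalIntegrable (by rw [uIcc_of_le h0] at hw ⊢; exact hw.mul (hzc.pow 2))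
  have h1 := W.integral_weight_mul_position_sq_le hlam (j := i + 1) (by omega)
  have hR := (W.source_sq_integrable i hi).const_mul (2 * f (i + 1) ^ 2)
  calc _ ≤ ∫ t in (0 : ℝ)..T, (2 * f (i + 1) ^ 2 * R' t (i + 1) ^ 2
          + 2 * m ^ 2 * (Real.exp (-lam * t) * z t (i + 1) ^ 2)) := by
        refine intervalIntegral.integral_mono_on h0 ((W.force_sq_integrable hi).continuousOn_mul hw)
          (hR.add (hwz.const_mul _)) fun t ht => ?_
        have hq : q (i + 1) ^ 2 ≤ m ^ 2 := by
          rw [← sq_abs]; gcongr; exact W.potential_le i hi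
        have hw1 : Real.exp (-lam * t) ≤ 1 := Real.exp_le_one_iff.2 (by nlinarith [ht.1])
        have e1 : force q f R' z t (i + 1) ^ 2
            ≤ 2 * (f (i + 1) ^ 2 * R' t (i + 1) ^ 2) + 2 * (q (i + 1) ^ 2 * z t (i + 1) ^ 2) := by
          unfold force
          nlinarith [sq_nonneg (f (i + 1) * R' t (i + 1) + q (i + 1) * z t (i + 1))]
        have e2 : q (i + 1) ^ 2 * z t (i + 1) ^ 2 ≤ m ^ 2 * z t (i + 1) ^ 2 := by gcongr
        have e3 : Real.exp (-lam * t) * (f (i + 1) ^ 2 * R' t (i + 1) ^ 2)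
            ≤ 1 * (f (i + 1) ^ 2 * R' t (i + 1) ^ 2) := by gcongr
        calc _ ≤ Real.exp (-lam * t) * (2 * (f (i + 1) ^ 2 * R' t (i + 1) ^ 2)
              + 2 * (m ^ 2 * z t (i + 1) ^ 2)) := by gcongr; linarith
          _ ≤ _ := by linarith
    _ = 2 * f (i + 1) ^ 2 * (∫ t in (0 : ℝ)..T, R' t (i + 1) ^ 2)
        + 2 * m ^ 2 * ∫ t in (0 : ℝ)..T, Real.exp (-lam * t) * z t (i + 1) ^ 2 := by
      rw [intervalIntegral.integral_add hR (hwz.const_mul _), intervalIntegral.integral_const_mul,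
        intervalIntegral.integral_const_mul]
    _ ≤ 2 * f (i + 1) ^ 2 * K ^ 2 + 2 * m ^ 2 * (T ^ 2 *
        ∫ t in (0 : ℝ)..T, Real.exp (-lam * t) * p t (i + 1) ^ 2) := by
      gcongr
      exact W.source_le i hi
    _ = _ := by ring

omit W in
theorem integral_weight_mul_massSum {w : ℝ → ℝ} {θ : ℕ → ℝ} {v : ℝ → ℕ → ℝ}
    (hv : ∀ i < N, IntervalIntegrable (fun t => w t * v t (i + 1) ^ 2) volume 0 T) :
    ∫ t in (0 : ℝ)..T, w t * massSum N θ (v t)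
      = mesh N * ∑ i ∈ Finset.range N, θ (i + 1) * ∫ t in (0 : ℝ)..T, w t * v t (i + 1) ^ 2 := by
  have e : ∀ t, w t * massSum N θ (v t)
      = mesh N * ∑ i ∈ Finset.range N, θ (i + 1) * (w t * v t (i + 1) ^ 2) := fun t => by
    unfold massSum
    rw [mul_left_comm, Finset.mul_sum]
    congr 1
    exact Finset.sum_congr rfl fun i _ => by ring
  simp_rw [e]
  rw [intervalIntegral.integral_const_mul, intervalIntegral.integral_finsetSum
    fun i hi => (hv i (Finset.mem_range.1 hi)).const_mul _]
  simp_rw [intervalIntegral.integral_const_mul]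

theorem integral_weight_mul_massSum_force_le {lam : ℝ} (hlam : 0 ≤ lam) {θ : ℕ → ℝ}
    (hθ : ∀ i, 0 ≤ θ i) :
    ∫ t in (0 : ℝ)..T, Real.exp (-lam * t) * massSum N θ (force q f R' z t)
      ≤ 2 * K ^ 2 * massSum N θ f
        + 2 * m ^ 2 * T ^ 2 * ∫ t in (0 : ℝ)..T, Real.exp (-lam * t) * massSum N θ (p t) := by
  have h0 := W.time_pos.le
  have hw : ContinuousOn (fun t => Real.exp (-lam * t)) (uIcc 0 T) := by fun_prop
  rw [integral_weight_mul_massSum fun i hi => (W.force_sq_integrable hi).continuousOn_mul hw,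
    integral_weight_mul_massSum fun i hi => ContinuousOn.intervalIntegrable (by
      rw [uIcc_of_le h0] at hw ⊢
      exact hw.mul ((W.continuousOn_velocity (by omega)).pow 2))]
  unfold massSum
  rw [mul_left_comm, mul_left_comm (2 * m ^ 2 * T ^ 2), ← mul_add, Finset.mul_sum _ _ (2 * K ^ 2),
    Finset.mul_sum _ _ (2 * m ^ 2 * T ^ 2), ← Finset.sum_add_distrib]
  refine mul_le_mul_of_nonneg_left (Finset.sum_le_sum fun i hi => ?_) (mesh_pos N).le
  have := mul_le_mul_of_nonneg_left
    (W.integral_weight_mul_force_sq_le hlam (Finset.mem_range.1 hi)) (hθ (i + 1))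
  linarith

end IsDifferentiatedWave

/-! ### Multiplier inequalities at a fixed time -/

theorem abs_mul_le_weighted_sq {κ : ℝ} (hκ : 0 < κ) (x y : ℝ) :
    |x * y| ≤ 1 / (2 * κ) * x ^ 2 + κ / 2 * y ^ 2 := by
  have h1 : 0 ≤ 1 / (2 * κ) * (|x| - κ * |y|) ^ 2 := by positivity
  have h2 : 1 / (2 * κ) * (|x| - κ * |y|) ^ 2
      = 1 / (2 * κ) * x ^ 2 + κ / 2 * y ^ 2 - |x| * |y| := by
    rw [← sq_abs x, ← sq_abs y]; field_simp; ring
  rw [abs_mul]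
  linarith

theorem sum_succ_le_sum {N : ℕ} {φ : ℕ → ℝ} (hφ : 0 ≤ φ 0) :
    ∑ i ∈ Finset.range N, φ (i + 1) ≤ ∑ i ∈ Finset.range (N + 1), φ i := by
  rw [Finset.sum_range_succ']
  linarith

theorem sum_le_sum_succ {N : ℕ} {φ : ℕ → ℝ} (hφ : 0 ≤ φ N) :
    ∑ i ∈ Finset.range N, φ i ≤ ∑ i ∈ Finset.range (N + 1), φ i := by
  rw [Finset.sum_range_succ]
  linarith

/-- Pairing of an interior grid function with the centered difference of `z`. -/
theorem abs_sum_mul_centered_le {N : ℕ} {θ ϑ : ℕ → ℝ} {a κ : ℝ} (hκ : 0 < κ)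
    (hθ : ∀ i < N, 0 ≤ θ (i + 1)) (hθϑ : ∀ i < N, θ (i + 1) ≤ ϑ (i + 1)) (hϑ : ∀ i, 0 ≤ ϑ i)
    (ha0 : 0 ≤ a) (ha : ∀ i, ϑ (i + 1) ≤ a * ϑ i) (G z : ℕ → ℝ) :
    |∑ i ∈ Finset.range N, θ (i + 1) * G (i + 1) * ((z (i + 2) - z i) / 2)|
      ≤ 1 / (2 * κ) * massSum N ϑ G + κ / 2 * ((1 + a) / 2 * gradSum N ϑ z) := by
  have hh := mesh_pos N
  have e1 : ∀ i ∈ Finset.range N, |θ (i + 1) * G (i + 1) * ((z (i + 2) - z i) / 2)|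
      ≤ 1 / (2 * κ) * (mesh N * (ϑ (i + 1) * G (i + 1) ^ 2)) + κ / 2 * ((mesh N)⁻¹ *
        (1 / 2 * (ϑ (i + 1) * (z (i + 1 + 1) - z (i + 1)) ^ 2)
          + a / 2 * (ϑ i * (z (i + 1) - z i) ^ 2))) := by
    intro i hi
    have hi := Finset.mem_range.1 hi
    rw [mul_assoc, abs_mul, abs_of_nonneg (hθ i hi)]
    -- The factor h⁻¹ matches the scalings h of `massSum` and h⁻¹ of `gradSum`.
    have b1 := abs_mul_le_weighted_sq (κ := κ * (mesh N)⁻¹) (by positivity) (G (i + 1))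
      ((z (i + 2) - z i) / 2)
    have b2 : ((z (i + 2) - z i) / 2) ^ 2 ≤ 1 / 2 * (z (i + 1 + 1) - z (i + 1)) ^ 2
        + 1 / 2 * (z (i + 1) - z i) ^ 2 := by
      nlinarith [sq_nonneg ((z (i + 1 + 1) - z (i + 1)) - (z (i + 1) - z i))]
    have b3 : ϑ (i + 1) * (1 / 2 * (z (i + 1) - z i) ^ 2) ≤ a * ϑ i * (1 / 2 * (z (i + 1) - z i) ^ 2) :=
      mul_le_mul_of_nonneg_right (ha i) (by positivity)
    have e0 : 1 / (2 * (κ * (mesh N)⁻¹)) = 1 / (2 * κ) * mesh N := by field_simp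
    rw [e0] at b1
    calc _ ≤ ϑ (i + 1) * |G (i + 1) * ((z (i + 2) - z i) / 2)| :=
          mul_le_mul_of_nonneg_right (hθϑ i hi) (abs_nonneg _)
      _ ≤ ϑ (i + 1) * (1 / (2 * κ) * mesh N * G (i + 1) ^ 2 + κ * (mesh N)⁻¹ / 2 *
          (1 / 2 * (z (i + 1 + 1) - z (i + 1)) ^ 2 + 1 / 2 * (z (i + 1) - z i) ^ 2)) := by
        refine mul_le_mul_of_nonneg_left (b1.trans ?_) (hϑ _)
        gcongr
      _ = 1 / (2 * κ) * mesh N * (ϑ (i + 1) * G (i + 1) ^ 2) + κ * (mesh N)⁻¹ / 2 *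
          (1 / 2 * (ϑ (i + 1) * (z (i + 1 + 1) - z (i + 1)) ^ 2)
            + ϑ (i + 1) * (1 / 2 * (z (i + 1) - z i) ^ 2)) := by ring
      _ ≤ 1 / (2 * κ) * mesh N * (ϑ (i + 1) * G (i + 1) ^ 2) + κ * (mesh N)⁻¹ / 2 *
          (1 / 2 * (ϑ (i + 1) * (z (i + 1 + 1) - z (i + 1)) ^ 2)
            + a * ϑ i * (1 / 2 * (z (i + 1) - z i) ^ 2)) := by gcongr
      _ = _ := by ring
  refine (Finset.abs_sum_le_sum_abs _ _).trans ((Finset.sum_le_sum e1).trans ?_)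
  have s1 := sum_succ_le_sum (N := N) (φ := fun i => ϑ i * (z (i + 1) - z i) ^ 2)
    (mul_nonneg (hϑ _) (sq_nonneg _))
  have s2 := sum_le_sum_succ (N := N) (φ := fun i => ϑ i * (z (i + 1) - z i) ^ 2)
    (mul_nonneg (hϑ _) (sq_nonneg _))
  rw [Finset.sum_add_distrib, ← Finset.mul_sum, ← Finset.mul_sum, ← Finset.mul_sum,
    ← Finset.mul_sum, Finset.sum_add_distrib, ← Finset.mul_sum, ← Finset.mul_sum]
  unfold massSum gradSum
  refine add_le_add_right (mul_le_mul_of_nonneg_left ?_ (by positivity)) _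
  have : a / 2 * ∑ i ∈ Finset.range N, ϑ i * (z (i + 1) - z i) ^ 2
      ≤ a / 2 * ∑ i ∈ Finset.range (N + 1), ϑ i * (z (i + 1) - z i) ^ 2 :=
    mul_le_mul_of_nonneg_left s2 (by positivity)
  rw [mul_left_comm]
  refine mul_le_mul_of_nonneg_left ?_ (inv_nonneg.2 hh.le)
  beta_reduce at s1
  linarith

/-- Young's inequality on both terms of the energy identity. The increments of θ are O(σhθ), and
this factor h is what bounds the commutator by σ times the energy, uniformly in the mesh. -/
theorem abs_energy_deriv_le {N : ℕ} {θ : ℕ → ℝ} {σ μ : ℝ} (hμ : 0 < μ) (hσ : 0 ≤ σ)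
    (hθ : ∀ i, 0 ≤ θ i) (hmono : ∀ i, θ i ≤ θ (i + 1))
    (hgrow : ∀ i, θ (i + 1) - θ i ≤ σ * mesh N * θ i) (z p F : ℕ → ℝ) :
    |mesh N * ∑ i ∈ Finset.range N, θ (i + 1) * p (i + 1) * F (i + 1)
      - (mesh N)⁻¹ * ∑ i ∈ Finset.range N, (θ (i + 1) - θ i) * (p (i + 1) * (z (i + 1) - z i))|
      ≤ (σ + μ) * energy N θ z p + 1 / (2 * μ) * massSum N θ F := by
  have hh := mesh_pos N
  have e1 : |mesh N * ∑ i ∈ Finset.range N, θ (i + 1) * p (i + 1) * F (i + 1)|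
      ≤ 1 / (2 * μ) * massSum N θ F + μ / 2 * massSum N θ p := by
    rw [abs_mul, abs_of_pos hh]
    unfold massSum
    rw [mul_left_comm, mul_left_comm (μ / 2), ← mul_add, Finset.mul_sum, Finset.mul_sum _ _ (μ / 2),
      ← Finset.sum_add_distrib]
    refine mul_le_mul_of_nonneg_left ((Finset.abs_sum_le_sum_abs _ _).trans
      (Finset.sum_le_sum fun i _ => ?_)) hh.le
    have := mul_le_mul_of_nonneg_left (abs_mul_le_weighted_sq hμ (F (i + 1)) (p (i + 1)))
      (hθ (i + 1))
    rw [mul_assoc, abs_mul, abs_of_nonneg (hθ _), mul_comm (p (i + 1))]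
    linarith
  have e2 : |(mesh N)⁻¹ * ∑ i ∈ Finset.range N,
        (θ (i + 1) - θ i) * (p (i + 1) * (z (i + 1) - z i))| ≤ σ * energy N θ z p := by
    rw [abs_mul, abs_of_pos (inv_pos.2 hh)]
    have t : ∀ i ∈ Finset.range N, |(θ (i + 1) - θ i) * (p (i + 1) * (z (i + 1) - z i))|
        ≤ σ / 2 * mesh N ^ 2 * (θ (i + 1) * p (i + 1) ^ 2)
          + σ / 2 * (θ i * (z (i + 1) - z i) ^ 2) := by
      intro i _
      have b := abs_mul_le_weighted_sq (κ := (mesh N)⁻¹) (inv_pos.2 hh) (p (i + 1)) (z (i + 1) - z i)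
      have e0 : 1 / (2 * (mesh N)⁻¹) = mesh N / 2 := by field_simp
      rw [e0] at b
      rw [abs_mul, abs_of_nonneg (sub_nonneg.2 (hmono i))]
      have hθi := hθ i
      calc _ ≤ σ * mesh N * θ i * |p (i + 1) * (z (i + 1) - z i)| :=
            mul_le_mul_of_nonneg_right (hgrow i) (abs_nonneg _)
        _ ≤ σ * mesh N * θ i * (mesh N / 2 * p (i + 1) ^ 2
              + (mesh N)⁻¹ / 2 * (z (i + 1) - z i) ^ 2) := by gcongr
        _ = σ / 2 * mesh N ^ 2 * (θ i * p (i + 1) ^ 2) + σ / 2 * (θ i * (z (i + 1) - z i) ^ 2) := by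
          field_simp
        _ ≤ _ := by gcongr; exact hmono i
    have s2 := sum_le_sum_succ (N := N) (φ := fun i => θ i * (z (i + 1) - z i) ^ 2)
      (mul_nonneg (hθ _) (sq_nonneg _))
    calc _ ≤ (mesh N)⁻¹ * ∑ i ∈ Finset.range N, (σ / 2 * mesh N ^ 2 * (θ (i + 1) * p (i + 1) ^ 2)
          + σ / 2 * (θ i * (z (i + 1) - z i) ^ 2)) := by
          refine mul_le_mul_of_nonneg_left ((Finset.abs_sum_le_sum_abs _ _).trans
            (Finset.sum_le_sum t)) (by positivity)
      _ ≤ (mesh N)⁻¹ * (σ / 2 * mesh N ^ 2 * (∑ i ∈ Finset.range N, θ (i + 1) * p (i + 1) ^ 2)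
          + σ / 2 * ∑ i ∈ Finset.range (N + 1), θ i * (z (i + 1) - z i) ^ 2) := by
          rw [Finset.sum_add_distrib, ← Finset.mul_sum, ← Finset.mul_sum]
          gcongr
      _ = _ := by unfold energy massSum gradSum; field_simp
  have e3 : μ / 2 * massSum N θ p ≤ μ * energy N θ z p := by
    unfold energy
    nlinarith [gradSum_nonneg (N := N) hθ z]
  refine (abs_sub _ _).trans ?_
  linarith

/-- The Lagrangian multiplier inequality, with spatial weights `θ_i = (1 + s h)^i` and time decay
rate `c s`, where `c < 1`. -/
theorem momentum_deriv_le {N : ℕ} {θ : ℕ → ℝ} {s c ε : ℝ} (hs : 0 < s) (hε : 0 < ε) (hc : 0 ≤ c)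
    (hcε : c + 4 * ε ≤ 1) (hsh : s * mesh N ≤ ε) (hθ : ∀ i, 0 ≤ θ i)
    (hstep : ∀ i, θ (i + 1) = (1 + s * mesh N) * θ i) {z p F : ℕ → ℝ} (hp0 : p 0 = 0)
    (hpN : p (N + 1) = 0) :
    -(c * s) * momentum N θ z p
      + (∑ i ∈ Finset.range N, θ (i + 1) * F (i + 1) * ((z (i + 2) - z i) / 2)
      + (θ (N + 1) * (z (N + 1) - z N) ^ 2 - θ 0 * (z 1 - z 0) ^ 2
        - ∑ i ∈ Finset.range (N + 1), (θ (i + 1) - θ i) * (z (i + 1) - z i) ^ 2)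
          / (2 * mesh N ^ 2)
      - (∑ i ∈ Finset.range (N + 1), (θ (i + 1) - θ i) * (p i * p (i + 1))) / 2)
      ≤ θ (N + 1) * (z (N + 1) - z N) ^ 2 / (2 * mesh N ^ 2)
        + s / 4 * (mesh N ^ 2 * gradSum N θ p)
        + 1 / (2 * (ε * s)) * massSum N θ F - 2 * ε * s * energy N θ z p := by
  have hh := mesh_pos N
  set h := mesh N with hdef
  set η := s * h with hη
  have hη0 : 0 < η := mul_pos hs hh
  set P := massSum N θ p with hP
  set D := gradSum N θ z with hD
  have hP0 : 0 ≤ P := massSum_nonneg hθ p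
  have hD0 : 0 ≤ D := gradSum_nonneg hθ z
  have t1 := le_of_abs_le (abs_sum_mul_centered_le (N := N) (θ := θ) (ϑ := θ) (a := 1 + η)
    (mul_pos hε hs) (fun _ _ => hθ _) (fun _ _ => le_rfl) hθ (by positivity) (fun i => (hstep i).le) F z)
  have t2 := neg_le_of_abs_le (abs_sum_mul_centered_le (N := N) (θ := θ) (ϑ := θ) (a := 1 + η)
    one_pos (fun _ _ => hθ _) (fun _ _ => le_rfl) hθ (by positivity) (fun i => (hstep i).le) p z)
  have t2' : -(c * s) * momentum N θ z p ≤ c * s * (1 / 2 * P + 1 / 2 * ((1 + (1 + η)) / 2 * D)) := by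
    have := mul_le_mul_of_nonneg_left t2 (mul_nonneg hc hs.le)
    unfold momentum
    linarith
  have t3 : ∑ i ∈ Finset.range (N + 1), (θ (i + 1) - θ i) * (z (i + 1) - z i) ^ 2 = s * h ^ 2 * D := by
    have : s * h ^ 2 * D = η * ∑ i ∈ Finset.range (N + 1), θ i * (z (i + 1) - z i) ^ 2 := by
      rw [hD, gradSum, ← hdef]; field_simp; rw [hη]; ring
    rw [this, Finset.mul_sum]
    exact Finset.sum_congr rfl fun i _ => by rw [hstep]; ring
  -- Polarization of p_i p_{i+1}: the term (p_{i+1} - p_i)² is the origin of the Tychonoff term.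
  have t4 : ∑ i ∈ Finset.range (N + 1), (θ (i + 1) - θ i) * (p i * p (i + 1))
      = η / 2 * (∑ i ∈ Finset.range (N + 1), θ i * p i ^ 2
        + ∑ i ∈ Finset.range (N + 1), θ i * p (i + 1) ^ 2
        - ∑ i ∈ Finset.range (N + 1), θ i * (p (i + 1) - p i) ^ 2) := by
    rw [← Finset.sum_add_distrib, ← Finset.sum_sub_distrib, Finset.mul_sum]
    exact Finset.sum_congr rfl fun i _ => by rw [hstep]; ring
  have t5 : h * ∑ i ∈ Finset.range (N + 1), θ i * p i ^ 2 = P := by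
    rw [Finset.sum_range_succ', hp0]; simp [hP, massSum, hdef]
  -- Shifting the weight by one node costs 1 - η, because (1 - η)(1 + η) ≤ 1.
  have t6 : (1 - η) * P ≤ h * ∑ i ∈ Finset.range (N + 1), θ i * p (i + 1) ^ 2 := by
    rw [Finset.sum_range_succ, hpN, hP, massSum, ← hdef, mul_left_comm, Finset.mul_sum]
    refine mul_le_mul_of_nonneg_left ?_ hh.le
    have : ∀ i ∈ Finset.range N, (1 - η) * (θ (i + 1) * p (i + 1) ^ 2) ≤ θ i * p (i + 1) ^ 2 := by
      intro i _
      have h1 : (1 - η) * θ (i + 1) ≤ θ i := by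
        rw [hstep]
        nlinarith [mul_nonneg (sq_nonneg η) (hθ i)]
      nlinarith [sq_nonneg (p (i + 1))]
    have := Finset.sum_le_sum this
    simpa using this
  have t7 : h ^ 2 * gradSum N θ p = h * ∑ i ∈ Finset.range (N + 1), θ i * (p (i + 1) - p i) ^ 2 := by
    rw [gradSum, ← hdef]; field_simp
  have t4' : (∑ i ∈ Finset.range (N + 1), (θ (i + 1) - θ i) * (p i * p (i + 1))) / 2
      ≥ s / 4 * (P + (1 - η) * P - h ^ 2 * gradSum N θ p) := by
    rw [t4, t7, ← t5]
    have := mul_le_mul_of_nonneg_left t6 hs.le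
    rw [← t5] at this
    rw [hη] at this ⊢
    linarith
  have t8 : (θ (N + 1) * (z (N + 1) - z N) ^ 2 - θ 0 * (z 1 - z 0) ^ 2 - s * h ^ 2 * D) / (2 * h ^ 2)
      ≤ θ (N + 1) * (z (N + 1) - z N) ^ 2 / (2 * h ^ 2) - s / 2 * D := by
    have : s / 2 * D = s * h ^ 2 * D / (2 * h ^ 2) := by field_simp
    rw [this, ← sub_div]
    have := mul_nonneg (hθ 0) (sq_nonneg (z 1 - z 0))
    gcongr
    linarith
  rw [t3]
  -- The margin 4ε below c = 1 pays for the errors in η ≤ ε, for Young's inequality and for the ε s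
  -- retained in front of P and D.
  have hPc : s * P * (c / 2 - 1 / 2 + η / 4 + ε) ≤ 0 :=
    mul_nonpos_of_nonneg_of_nonpos (by positivity) (by linarith)
  have hDc : s * D * ((c / 2 + ε / 2) * (1 + η / 2) - 1 / 2 + ε) ≤ 0 :=
    mul_nonpos_of_nonneg_of_nonpos (by positivity) (by nlinarith)
  have hE : energy N θ z p = (P + D) / 2 := rfl
  rw [hE]
  linarith

/-- The multiplier `x_j ∂_h z` controls the flux at `x = 1`. -/
theorem flux_sq_le {N : ℕ} {z p F : ℕ → ℝ} (hp0 : p 0 = 0) (hpN : p (N + 1) = 0) :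
    (z (N + 1) - z N) ^ 2 / (2 * mesh N ^ 2)
      ≤ (∑ i ∈ Finset.range N, mesh N * ((i + 1 : ℕ) : ℝ) * F (i + 1) * ((z (i + 2) - z i) / 2)
      + (mesh N * ((N + 1 : ℕ) : ℝ) * (z (N + 1) - z N) ^ 2 - mesh N * ((0 : ℕ) : ℝ) * (z 1 - z 0) ^ 2
        - ∑ i ∈ Finset.range (N + 1), (mesh N * ((i + 1 : ℕ) : ℝ) - mesh N * (i : ℝ))
            * (z (i + 1) - z i) ^ 2) / (2 * mesh N ^ 2)
      - (∑ i ∈ Finset.range (N + 1), (mesh N * ((i + 1 : ℕ) : ℝ) - mesh N * (i : ℝ))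
          * (p i * p (i + 1))) / 2)
      + (1 / 2 * massSum N (fun _ => 1) F + 2 * energy N (fun _ => 1) z p) := by
  have hh := mesh_pos N
  have hmul := mesh_mul N
  have hone : ∀ i < N, mesh N * ((i + 1 : ℕ) : ℝ) ≤ 1 := fun i hi => by
    rw [← hmul]
    have : ((i + 1 : ℕ) : ℝ) ≤ (N : ℝ) + 1 := by exact_mod_cast (by omega : i + 1 ≤ N + 1)
    gcongr
  -- The weight x_j vanishes at the left end and so violates the growth condition; the constant
  -- weight 1 dominates it.
  have t1 := neg_le_of_abs_le (abs_sum_mul_centered_le (N := N) (θ := fun i => mesh N * (i : ℝ))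
    (ϑ := fun _ => 1) (a := 1) one_pos (fun i _ => by positivity) hone (fun _ => zero_le_one)
    zero_le_one (fun i => by simp) F z)
  set h := mesh N with hdef
  have hD : ∑ i ∈ Finset.range (N + 1), (h * ((i + 1 : ℕ) : ℝ) - h * (i : ℝ)) * (z (i + 1) - z i) ^ 2
      = h ^ 2 * gradSum N (fun _ => 1) z := by
    have : h ^ 2 * gradSum N (fun _ => 1) z = h * ∑ i ∈ Finset.range (N + 1), (z (i + 1) - z i) ^ 2 := by
      simp only [gradSum, ← hdef, one_mul]; field_simp
    rw [this, Finset.mul_sum]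
    exact Finset.sum_congr rfl fun i _ => by push_cast; ring
  have hP : ∑ i ∈ Finset.range (N + 1), (h * ((i + 1 : ℕ) : ℝ) - h * (i : ℝ)) * (p i * p (i + 1))
      ≤ massSum N (fun _ => 1) p := by
    have e1 : ∑ i ∈ Finset.range (N + 1), p i ^ 2 = ∑ i ∈ Finset.range N, p (i + 1) ^ 2 := by
      rw [Finset.sum_range_succ', hp0]; simp
    have e2 : ∑ i ∈ Finset.range (N + 1), p (i + 1) ^ 2 = ∑ i ∈ Finset.range N, p (i + 1) ^ 2 := by
      rw [Finset.sum_range_succ, hpN]; simp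
    have e3 : massSum N (fun _ => 1) p
        = ∑ i ∈ Finset.range (N + 1), h * (p i ^ 2 / 2 + p (i + 1) ^ 2 / 2) := by
      rw [← Finset.mul_sum, Finset.sum_add_distrib, ← Finset.sum_div, ← Finset.sum_div, e1, e2]
      simp only [massSum, one_mul, ← hdef]
      ring
    rw [e3]
    refine Finset.sum_le_sum fun i _ => ?_
    push_cast
    have : (h * ((i : ℝ) + 1) - h * i) = h := by ring
    rw [this]
    refine mul_le_mul_of_nonneg_left ?_ hh.le
    nlinarith [sq_nonneg (p i - p (i + 1))]
  have hN : h * ((N + 1 : ℕ) : ℝ) = 1 := by push_cast; exact hmul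
  rw [hD, hN, Nat.cast_zero]
  have e4 : (1 * (z (N + 1) - z N) ^ 2 - h * 0 * (z 1 - z 0) ^ 2 - h ^ 2 * gradSum N (fun _ => 1) z)
      / (2 * h ^ 2) = (z (N + 1) - z N) ^ 2 / (2 * h ^ 2) - 1 / 2 * gradSum N (fun _ => 1) z := by
    field_simp
    ring
  rw [e4]
  have hP0 := massSum_nonneg (N := N) (θ := fun _ => 1) (fun _ => zero_le_one) p
  unfold energy
  linarith

/-! ### Estimates integrated in time -/

namespace HasACDeriv

variable {T : ℝ} {F F' : ℝ → ℝ}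

theorem exp_mul (h : HasACDeriv T F F') (hT : 0 ≤ T) (lam : ℝ) :
    HasACDeriv T (fun t => Real.exp (-lam * t) * F t)
      (fun t => Real.exp (-lam * t) * (-lam * F t + F' t)) := by
  have hw : HasACDeriv T (fun t => Real.exp (-lam * t)) (fun t => -lam * Real.exp (-lam * t)) := by
    refine of_hasDerivAt hT (fun t => ?_) (by fun_prop)
    have h1 : HasDerivAt (fun t : ℝ => -lam * t) (-lam) t := by
      simpa using (hasDerivAt_id t).const_mul (-lam)
    simpa [mul_comm] using h1.exp
  refine (hw.mul h hT).congr hT (fun t _ => rfl) (fun t _ => ?_)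
  beta_reduce
  ring

theorem sub_le_integral (h : HasACDeriv T F F') (hT : 0 ≤ T) {B : ℝ → ℝ}
    (hB : IntervalIntegrable B volume 0 T) (hle : ∀ t ∈ Icc 0 T, F' t ≤ B t) :
    F T - F 0 ≤ ∫ t in (0 : ℝ)..T, B t := by
  rw [← h.integral_eq hT]
  exact intervalIntegral.integral_mono_on hT h.1 hB hle

end HasACDeriv

theorem massSum_mono_weight {N : ℕ} {θ ϑ : ℕ → ℝ} (h : ∀ i < N, θ (i + 1) ≤ ϑ (i + 1)) (v : ℕ → ℝ) :
    massSum N θ v ≤ massSum N ϑ v := by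
  refine mul_le_mul_of_nonneg_left (Finset.sum_le_sum fun i hi => ?_) (mesh_pos N).le
  exact mul_le_mul_of_nonneg_right (h i (Finset.mem_range.1 hi)) (sq_nonneg _)

theorem gradSum_mono_weight {N : ℕ} {θ ϑ : ℕ → ℝ} (h : ∀ i ≤ N, θ i ≤ ϑ i) (v : ℕ → ℝ) :
    gradSum N θ v ≤ gradSum N ϑ v := by
  refine mul_le_mul_of_nonneg_left (Finset.sum_le_sum fun i hi => ?_) (inv_nonneg.2 (mesh_pos N).le)
  exact mul_le_mul_of_nonneg_right (h i (by have := Finset.mem_range.1 hi; omega)) (sq_nonneg _)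

theorem massSum_mul_weight {N : ℕ} (c : ℝ) (v : ℕ → ℝ) :
    massSum N (fun _ => c) v = c * massSum N (fun _ => 1) v := by
  simp only [massSum, ← Finset.mul_sum, one_mul]; ring

theorem gradSum_mul_weight {N : ℕ} (c : ℝ) (v : ℕ → ℝ) :
    gradSum N (fun _ => c) v = c * gradSum N (fun _ => 1) v := by
  simp only [gradSum, ← Finset.mul_sum, one_mul]; ring

theorem abs_momentum_le {N : ℕ} {θ ϑ : ℕ → ℝ} {a : ℝ} (hθ : ∀ i < N, 0 ≤ θ (i + 1))
    (hθϑ : ∀ i < N, θ (i + 1) ≤ ϑ (i + 1)) (hϑ : ∀ i, 0 ≤ ϑ i) (ha1 : 0 ≤ a) (ha3 : a ≤ 3)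
    (ha : ∀ i, ϑ (i + 1) ≤ a * ϑ i) (z p : ℕ → ℝ) :
    |momentum N θ z p| ≤ 2 * energy N ϑ z p := by
  have := abs_sum_mul_centered_le one_pos hθ hθϑ hϑ ha1 ha p z
  have h1 := massSum_nonneg (N := N) hϑ p
  have h2 := gradSum_nonneg (N := N) hϑ z
  have h3 : (1 + a) / 2 * gradSum N ϑ z ≤ 2 * gradSum N ϑ z := by gcongr; linarith
  unfold energy momentum
  linarith

namespace IsDifferentiatedWave

variable {T m K : ℝ} {N : ℕ} {q f R₀ : ℕ → ℝ} {R' z p : ℝ → ℕ → ℝ}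
  (W : IsDifferentiatedWave T m K N q f R₀ R' z p)
include W

theorem continuousOn_energy (θ : ℕ → ℝ) :
    ContinuousOn (fun t => energy N θ (z t) (p t)) (Icc 0 T) :=
  ((W.continuousOn_massSum θ).add (W.continuousOn_gradSum θ)).div_const 2

theorem weight_mul_integrable {g : ℝ → ℝ} (hg : ContinuousOn g (Icc 0 T)) (lam : ℝ) :
    IntervalIntegrable (fun t => Real.exp (-lam * t) * g t) volume 0 T := by
  refine ContinuousOn.intervalIntegrable ?_
  rw [uIcc_of_le W.time_pos.le]
  exact ContinuousOn.mul (by fun_prop) hg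

theorem weight_mul_massSum_force_integrable (θ : ℕ → ℝ) (lam : ℝ) :
    IntervalIntegrable (fun t => Real.exp (-lam * t) * massSum N θ (force q f R' z t)) volume 0 T :=
  (W.massSum_force_integrable θ).continuousOn_mul (by fun_prop)

/-- The two signs of the same derivative bound, integrated against e^{-λt}: the first recovers the
initial energy from later times, the second is a forward Gronwall estimate. -/
theorem energy_estimates {θ : ℕ → ℝ} {σ μ : ℝ} (hμ : 0 < μ) (hσ : 0 ≤ σ)
    (hθ : ∀ i, 0 ≤ θ i) (hmono : ∀ i, θ i ≤ θ (i + 1))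
    (hgrow : ∀ i, θ (i + 1) - θ i ≤ σ * mesh N * θ i) (lam : ℝ) :
    energy N θ (z 0) (p 0) ≤ Real.exp (-lam * T) * energy N θ (z T) (p T)
        + (lam + σ + μ) * (∫ t in (0 : ℝ)..T, Real.exp (-lam * t) * energy N θ (z t) (p t))
        + 1 / (2 * μ) * (∫ t in (0 : ℝ)..T, Real.exp (-lam * t) * massSum N θ (force q f R' z t)) ∧
    Real.exp (-lam * T) * energy N θ (z T) (p T)
        + (lam - σ - μ) * (∫ t in (0 : ℝ)..T, Real.exp (-lam * t) * energy N θ (z t) (p t))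
      ≤ energy N θ (z 0) (p 0)
        + 1 / (2 * μ) * (∫ t in (0 : ℝ)..T, Real.exp (-lam * t) * massSum N θ (force q f R' z t)) := by
  have h0 := W.time_pos.le
  have hE := W.weight_mul_integrable (W.continuousOn_energy θ) lam
  have hS := W.weight_mul_massSum_force_integrable θ lam
  have hd := (W.hasACDeriv_energy θ).exp_mul h0 lam
  have hb := fun t => abs_energy_deriv_le (N := N) hμ hσ hθ hmono hgrow (z t) (p t)
    (force q f R' z t)
  constructor
  · have := (hd.const_mul (-1)).sub_le_integral h0
      (B := fun t => (lam + σ + μ) * (Real.exp (-lam * t) * energy N θ (z t) (p t))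
        + 1 / (2 * μ) * (Real.exp (-lam * t) * massSum N θ (force q f R' z t)))
      ((hE.const_mul _).add (hS.const_mul _)) fun t _ => by
        have := mul_le_mul_of_nonneg_left (neg_le_of_abs_le (hb t)) (Real.exp_pos (-lam * t)).le
        linarith
    rw [intervalIntegral.integral_add (hE.const_mul _) (hS.const_mul _),
      intervalIntegral.integral_const_mul, intervalIntegral.integral_const_mul] at this
    simp only [mul_zero, Real.exp_zero, one_mul] at this
    linarith
  · have := hd.sub_le_integral h0
      (B := fun t => -(lam - σ - μ) * (Real.exp (-lam * t) * energy N θ (z t) (p t))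
        + 1 / (2 * μ) * (Real.exp (-lam * t) * massSum N θ (force q f R' z t)))
      ((hE.const_mul _).add (hS.const_mul _)) fun t _ => by
        have := mul_le_mul_of_nonneg_left (le_of_abs_le (hb t)) (Real.exp_pos (-lam * t)).le
        linarith
    rw [intervalIntegral.integral_add (hE.const_mul _) (hS.const_mul _),
      intervalIntegral.integral_const_mul, intervalIntegral.integral_const_mul] at this
    simp only [mul_zero, Real.exp_zero, one_mul] at this
    linarith

theorem integral_weight_mul_massSum_le {θ : ℕ → ℝ} (hθ : ∀ i, 0 ≤ θ i) (lam : ℝ) :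
    ∫ t in (0 : ℝ)..T, Real.exp (-lam * t) * massSum N θ (p t)
      ≤ 2 * ∫ t in (0 : ℝ)..T, Real.exp (-lam * t) * energy N θ (z t) (p t) := by
  rw [← intervalIntegral.integral_const_mul]
  refine intervalIntegral.integral_mono_on W.time_pos.le
    (W.weight_mul_integrable (W.continuousOn_massSum θ) lam)
    ((W.weight_mul_integrable (W.continuousOn_energy θ) lam).const_mul 2) fun t _ => ?_
  have : massSum N θ (p t) ≤ 2 * energy N θ (z t) (p t) := by
    unfold energy; linarith [gradSum_nonneg (N := N) hθ (z t)]
  have := mul_le_mul_of_nonneg_left this (Real.exp_pos (-lam * t)).le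
  linarith

theorem integral_weight_mul_force_le {lam : ℝ} (hlam : 0 ≤ lam) {θ : ℕ → ℝ} (hθ : ∀ i, 0 ≤ θ i) :
    ∫ t in (0 : ℝ)..T, Real.exp (-lam * t) * massSum N θ (force q f R' z t)
      ≤ 2 * K ^ 2 * massSum N θ f + 4 * m ^ 2 * T ^ 2 *
        ∫ t in (0 : ℝ)..T, Real.exp (-lam * t) * energy N θ (z t) (p t) := by
  have h1 := W.integral_weight_mul_massSum_force_le hlam hθ
  have h2 := mul_le_mul_of_nonneg_left (W.integral_weight_mul_massSum_le hθ lam)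
    (by positivity : 0 ≤ 2 * m ^ 2 * T ^ 2)
  linarith

/-- Since z(0) = 0, the initial energy is purely kinetic; here f is read off from the initial data.
-/
theorem energy_initial (θ : ℕ → ℝ) :
    energy N θ (z 0) (p 0)
      = mesh N * (∑ i ∈ Finset.range N, θ (i + 1) * (f (i + 1) * R₀ (i + 1)) ^ 2) / 2 := by
  have h1 : gradSum N θ (z 0) = 0 := by
    rw [gradSum, Finset.sum_eq_zero, mul_zero]
    intro i hi
    have := Finset.mem_range.1 hi
    rw [W.initial_position i (by omega), W.initial_position (i + 1) (by omega)]
    ring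
  rw [energy, h1, add_zero, massSum]
  congr 2
  exact Finset.sum_congr rfl fun i hi => by rw [W.initial_velocity i (Finset.mem_range.1 hi)]

theorem energy_initial_le {θ : ℕ → ℝ} (hθ : ∀ i, 0 ≤ θ i) {κ : ℝ}
    (hκ : ∀ i < N, R₀ (i + 1) ^ 2 ≤ κ) :
    energy N θ (z 0) (p 0) ≤ κ / 2 * massSum N θ f := by
  rw [W.energy_initial, massSum, mul_left_comm, mul_div_assoc, Finset.sum_div, Finset.mul_sum _ _ (κ / 2)]
  refine mul_le_mul_of_nonneg_left (Finset.sum_le_sum fun i hi => ?_) (mesh_pos N).le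
  have := mul_le_mul_of_nonneg_left (hκ i (Finset.mem_range.1 hi))
    (mul_nonneg (hθ (i + 1)) (sq_nonneg (f (i + 1))))
  rw [mul_pow]
  linarith

theorem le_energy_initial {θ : ℕ → ℝ} (hθ : ∀ i, 0 ≤ θ i) {r : ℝ} (hr : 0 ≤ r)
    (hR : ∀ i < N, r ≤ |R₀ (i + 1)|) :
    r ^ 2 / 2 * massSum N θ f ≤ energy N θ (z 0) (p 0) := by
  rw [W.energy_initial, massSum, mul_left_comm, mul_div_assoc, Finset.sum_div,
    Finset.mul_sum _ _ (r ^ 2 / 2)]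
  refine mul_le_mul_of_nonneg_left (Finset.sum_le_sum fun i hi => ?_) (mesh_pos N).le
  have h1 : r ^ 2 ≤ R₀ (i + 1) ^ 2 := by
    rw [← sq_abs (R₀ _)]; have := hR i (Finset.mem_range.1 hi); gcongr
  have := mul_le_mul_of_nonneg_left h1 (mul_nonneg (hθ (i + 1)) (sq_nonneg (f (i + 1))))
  rw [mul_pow]
  linarith

omit W in
/-- The constant of the forward energy estimate. -/
noncomputable def forwardConst (T m K κ : ℝ) : ℝ :=
  Real.exp ((2 + 2 * m ^ 2 * T ^ 2) * T) * (κ / 2 + K ^ 2)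

theorem energy_add_integral_energy_le {κ : ℝ} (hκ : ∀ i < N, R₀ (i + 1) ^ 2 ≤ κ) :
    energy N (fun _ => 1) (z T) (p T) + ∫ t in (0 : ℝ)..T, energy N (fun _ => 1) (z t) (p t)
      ≤ forwardConst T m K κ * massSum N (fun _ => 1) f := by
  have h0 := W.time_pos.le
  have hone : ∀ _ : ℕ, (0 : ℝ) ≤ 1 := fun _ => zero_le_one
  set lam := 2 + 2 * m ^ 2 * T ^ 2 with hlam
  have hlam0 : 0 ≤ lam := by positivity
  have h1 := (W.energy_estimates (θ := fun _ => 1) (σ := 0) one_pos le_rfl hone (fun _ => le_rfl)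
    (fun _ => by simp) lam).2
  have h2 := W.integral_weight_mul_force_le hlam0 hone
  have h3 := W.energy_initial_le hone hκ
  have hE0 : ∀ t, 0 ≤ energy N (fun _ => 1) (z t) (p t) := fun t => energy_nonneg hone _ _
  have h4 : Real.exp (-lam * T) * ∫ t in (0 : ℝ)..T, energy N (fun _ => 1) (z t) (p t)
      ≤ ∫ t in (0 : ℝ)..T, Real.exp (-lam * t) * energy N (fun _ => 1) (z t) (p t) := by
    rw [← intervalIntegral.integral_const_mul]
    refine intervalIntegral.integral_mono_on h0 (ContinuousOn.intervalIntegrable ?_)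
      (W.weight_mul_integrable (W.continuousOn_energy _) lam) fun t ht => ?_
    · rw [uIcc_of_le h0]
      exact continuousOn_const.mul (W.continuousOn_energy _)
    · refine mul_le_mul_of_nonneg_right (Real.exp_le_exp.2 ?_) (hE0 t)
      nlinarith [ht.2]
  set I := ∫ t in (0 : ℝ)..T, Real.exp (-lam * t) * energy N (fun _ => 1) (z t) (p t) with hI
  have h5 : Real.exp (-lam * T) * (energy N (fun _ => 1) (z T) (p T)
      + ∫ t in (0 : ℝ)..T, energy N (fun _ => 1) (z t) (p t))
      ≤ (κ / 2 + K ^ 2) * massSum N (fun _ => 1) f := by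
    -- λ was chosen so that exactly one copy of I remains once the feedback of the potential is
    -- absorbed.
    have : (lam - 0 - 1) * I = I + 1 / (2 * 1) * (4 * m ^ 2 * T ^ 2 * I) := by rw [hlam]; ring
    linarith
  have h6 := mul_le_mul_of_nonneg_left h5 (Real.exp_pos (lam * T)).le
  rw [← mul_assoc, ← Real.exp_add] at h6
  rw [show lam * T + -lam * T = 0 by ring, Real.exp_zero, one_mul] at h6
  rw [forwardConst, mul_assoc]
  exact h6

theorem continuousOn_flux_sq :
    ContinuousOn (fun t => (z t (N + 1) - z t N) ^ 2) (Icc 0 T) :=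
  ((W.continuousOn_position (by omega)).sub (W.continuousOn_position (by omega))).pow 2

/-- Hidden regularity: integrate the inequality for the multiplier x ∂_h z. The momentum vanishes at
t = 0 and is bounded by twice the energy at t = T. -/
theorem integral_flux_le {κ : ℝ} (hκ : ∀ i < N, R₀ (i + 1) ^ 2 ≤ κ) :
    ∫ t in (0 : ℝ)..T, (z t (N + 1) - z t N) ^ 2 / (2 * mesh N ^ 2)
      ≤ ((4 + 2 * m ^ 2 * T ^ 2) * forwardConst T m K κ + K ^ 2) * massSum N (fun _ => 1) f := by
  have h0 := W.time_pos.le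
  have hone : ∀ _ : ℕ, (0 : ℝ) ≤ 1 := fun _ => zero_le_one
  have hd := W.hasACDeriv_momentum (fun i => mesh N * (i : ℝ))
  have hE : IntervalIntegrable (fun t => energy N (fun _ => 1) (z t) (p t)) volume 0 T :=
    ContinuousOn.intervalIntegrable (by rw [uIcc_of_le h0]; exact W.continuousOn_energy _)
  have hS := W.massSum_force_integrable (fun _ => 1)
  have hfl : IntervalIntegrable (fun t => (z t (N + 1) - z t N) ^ 2 / (2 * mesh N ^ 2)) volume 0 T :=
    ContinuousOn.intervalIntegrable (by rw [uIcc_of_le h0]; exact W.continuousOn_flux_sq.div_const _)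
  have h1 := (hd.const_mul (-1)).sub_le_integral h0
    (B := fun t => (1 / 2 * massSum N (fun _ => 1) (force q f R' z t)
      + 2 * energy N (fun _ => 1) (z t) (p t)) - (z t (N + 1) - z t N) ^ 2 / (2 * mesh N ^ 2))
    (((hS.const_mul _).add (hE.const_mul _)).sub hfl) fun t ht => by
      have := flux_sq_le (N := N) (z := z t) (p := p t) (F := force q f R' z t)
        (W.velocity_left t ht) (W.velocity_right t ht)
      linarith
  rw [intervalIntegral.integral_sub ((hS.const_mul _).add (hE.const_mul _)) hfl,
    intervalIntegral.integral_add (hS.const_mul _) (hE.const_mul _),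
    intervalIntegral.integral_const_mul, intervalIntegral.integral_const_mul] at h1
  have hX0 : momentum N (fun i => mesh N * (i : ℝ)) (z 0) (p 0) = 0 := by
    refine Finset.sum_eq_zero fun i hi => ?_
    have := Finset.mem_range.1 hi
    rw [W.initial_position i (by omega), W.initial_position (i + 2) (by omega)]
    ring
  have hXT := le_of_abs_le (abs_momentum_le (N := N) (θ := fun i => mesh N * (i : ℝ))
    (ϑ := fun _ => 1) (a := 1) (fun i _ => mul_nonneg (mesh_pos N).le (Nat.cast_nonneg _))
    (fun i hi => by
      rw [← mesh_mul N]
      have : ((i + 1 : ℕ) : ℝ) ≤ (N : ℝ) + 1 := by exact_mod_cast (by omega : i + 1 ≤ N + 1)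
      exact mul_le_mul_of_nonneg_left this (mesh_pos N).le)
    hone zero_le_one (by norm_num) (fun _ => by simp) (z T) (p T))
  have hSle := W.integral_weight_mul_force_le (lam := 0) le_rfl hone
  simp only [neg_zero, zero_mul, Real.exp_zero, one_mul] at hSle
  have hfw := W.energy_add_integral_energy_le hκ
  have hE0 := energy_nonneg (N := N) hone (z T) (p T)
  have hI0 : 0 ≤ ∫ t in (0 : ℝ)..T, energy N (fun _ => 1) (z t) (p t) :=
    intervalIntegral.integral_nonneg h0 fun t _ => energy_nonneg hone _ _
  rw [hX0] at h1
  have h2 := mul_le_mul_of_nonneg_left hfw (by positivity : 0 ≤ 4 + 2 * m ^ 2 * T ^ 2)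
  have h3 : 0 ≤ (2 + 2 * m ^ 2 * T ^ 2) * energy N (fun _ => 1) (z T) (p T) := by positivity
  linarith

/-- A Carleman-type estimate, from `momentum_deriv_le` integrated in time. As z(0) = 0 kills the
momentum at t = 0, no cut-off is needed there, and the terminal momentum costs twice the weighted
energy. -/
theorem integral_weight_mul_energy_le {θ : ℕ → ℝ} {s c ε : ℝ} (hs : 0 < s) (hε : 0 < ε) (hc : 0 ≤ c)
    (hcε : c + 4 * ε ≤ 1) (hsh : s * mesh N ≤ ε) (hθ : ∀ i, 0 ≤ θ i)
    (hstep : ∀ i, θ (i + 1) = (1 + s * mesh N) * θ i) :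
    2 * ε * s * (∫ t in (0 : ℝ)..T, Real.exp (-(c * s) * t) * energy N θ (z t) (p t))
      ≤ 2 * (Real.exp (-(c * s) * T) * energy N θ (z T) (p T))
        + (∫ t in (0 : ℝ)..T, Real.exp (-(c * s) * t)
          * (θ (N + 1) * (z t (N + 1) - z t N) ^ 2 / (2 * mesh N ^ 2)
            + s / 4 * (mesh N ^ 2 * gradSum N θ (p t))))
        + 1 / (2 * (ε * s)) *
          ∫ t in (0 : ℝ)..T, Real.exp (-(c * s) * t) * massSum N θ (force q f R' z t) := by
  have h0 := W.time_pos.le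
  have hd := (W.hasACDeriv_momentum θ).exp_mul h0 (c * s)
  have hE := W.weight_mul_integrable (W.continuousOn_energy θ) (c * s)
  have hS := W.weight_mul_massSum_force_integrable θ (c * s)
  have hG : IntervalIntegrable (fun t => Real.exp (-(c * s) * t)
          * (θ (N + 1) * (z t (N + 1) - z t N) ^ 2 / (2 * mesh N ^ 2)
            + s / 4 * (mesh N ^ 2 * gradSum N θ (p t)))) volume 0 T :=
    W.weight_mul_integrable (((W.continuousOn_flux_sq.const_mul (θ (N + 1))).div_const
    (2 * mesh N ^ 2)).add (((W.continuousOn_gradSum_velocity θ).const_mul (mesh N ^ 2)).const_mul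
      (s / 4))) (c * s)
  have h1 := hd.sub_le_integral h0
    (B := fun t => Real.exp (-(c * s) * t)
          * (θ (N + 1) * (z t (N + 1) - z t N) ^ 2 / (2 * mesh N ^ 2)
            + s / 4 * (mesh N ^ 2 * gradSum N θ (p t)))
        + 1 / (2 * (ε * s)) * (Real.exp (-(c * s) * t) * massSum N θ (force q f R' z t))
        - 2 * ε * s * (Real.exp (-(c * s) * t) * energy N θ (z t) (p t)))
    ((hG.add (hS.const_mul _)).sub (hE.const_mul _)) fun t ht => by
      have := mul_le_mul_of_nonneg_left (momentum_deriv_le (N := N) (z := z t) (p := p t)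
        (F := force q f R' z t) hs hε hc hcε hsh hθ hstep
        (W.velocity_left t ht) (W.velocity_right t ht)) (Real.exp_pos (-(c * s) * t)).le
      linarith
  rw [intervalIntegral.integral_sub (hG.add (hS.const_mul _)) (hE.const_mul _),
    intervalIntegral.integral_add hG (hS.const_mul _),
    intervalIntegral.integral_const_mul, intervalIntegral.integral_const_mul] at h1
  have hX0 : momentum N θ (z 0) (p 0) = 0 := by
    refine Finset.sum_eq_zero fun i hi => ?_
    have := Finset.mem_range.1 hi
    rw [W.initial_position i (by omega), W.initial_position (i + 2) (by omega)]
    ring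
  have hsh0 : 0 ≤ s * mesh N := (mul_pos hs (mesh_pos N)).le
  have hXT := neg_le_of_abs_le (abs_momentum_le (N := N) (θ := θ) (ϑ := θ) (a := 1 + s * mesh N)
    (fun _ _ => hθ _) (fun _ _ => le_rfl) hθ (by positivity) (by linarith)
    (fun i => (hstep i).le) (z T) (p T))
  have := mul_le_mul_of_nonneg_left hXT (Real.exp_pos (-(c * s) * T)).le
  rw [hX0] at h1
  linarith

end IsDifferentiatedWave

/-! ### Poincaré and inverse inequalities, absorption of lower-order terms -/

/-- Discrete Poincaré inequality. -/
theorem massSum_le_gradSum {N : ℕ} {v : ℕ → ℝ} (hv : v 0 = 0) :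
    massSum N (fun _ => 1) v ≤ gradSum N (fun _ => 1) v := by
  have hh := mesh_pos N
  set S := ∑ i ∈ Finset.range (N + 1), (v (i + 1) - v i) ^ 2 with hS
  have hS0 : 0 ≤ S := Finset.sum_nonneg fun _ _ => sq_nonneg _
  have hinv : (mesh N)⁻¹ = (N : ℝ) + 1 := by unfold mesh; simp
  have hb : ∀ i ∈ Finset.range N, v (i + 1) ^ 2 ≤ ((N : ℝ) + 1) * S := by
    intro i hi
    have hi := Finset.mem_range.1 hi
    have e : v (i + 1) = ∑ k ∈ Finset.range (i + 1), (v (k + 1) - v k) := by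
      rw [Finset.sum_range_sub, hv, sub_zero]
    rw [e]
    refine (sq_sum_le_card_mul_sum_sq).trans ?_
    rw [Finset.card_range]
    have h1 : ((i + 1 : ℕ) : ℝ) ≤ (N : ℝ) + 1 := by exact_mod_cast (by omega : i + 1 ≤ N + 1)
    have h2 : ∑ k ∈ Finset.range (i + 1), (v (k + 1) - v k) ^ 2 ≤ S :=
      Finset.sum_le_sum_of_subset_of_nonneg (Finset.range_mono (by omega)) fun _ _ _ => sq_nonneg _
    exact mul_le_mul h1 h2 (Finset.sum_nonneg fun _ _ => sq_nonneg _) (by positivity)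
  have hsum := Finset.sum_le_sum hb
  rw [Finset.sum_const, Finset.card_range, nsmul_eq_mul] at hsum
  simp only [massSum, gradSum, one_mul, ← hS]
  calc _ ≤ mesh N * (N * (((N : ℝ) + 1) * S)) := by gcongr
    _ = (mesh N * (N + 1)) * (N * S) := by ring
    _ = N * S := by rw [mesh_mul, one_mul]
    _ ≤ (mesh N)⁻¹ * S := by rw [hinv]; gcongr; linarith

/-- Inverse inequality. -/
theorem gradSum_le_massSum {N : ℕ} {v : ℕ → ℝ} (hv : v 0 = 0) (hvN : v (N + 1) = 0) :
    mesh N ^ 2 * gradSum N (fun _ => 1) v ≤ 4 * massSum N (fun _ => 1) v := by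
  have hh := mesh_pos N
  have e1 : ∑ i ∈ Finset.range (N + 1), v i ^ 2 = ∑ i ∈ Finset.range N, v (i + 1) ^ 2 := by
    rw [Finset.sum_range_succ', hv]; simp
  have e2 : ∑ i ∈ Finset.range (N + 1), v (i + 1) ^ 2 = ∑ i ∈ Finset.range N, v (i + 1) ^ 2 := by
    rw [Finset.sum_range_succ, hvN]; simp
  have e3 : ∑ i ∈ Finset.range (N + 1), (v (i + 1) - v i) ^ 2
      ≤ ∑ i ∈ Finset.range (N + 1), (2 * v i ^ 2 + 2 * v (i + 1) ^ 2) :=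
    Finset.sum_le_sum fun i _ => by nlinarith [sq_nonneg (v i + v (i + 1))]
  rw [Finset.sum_add_distrib, ← Finset.mul_sum, ← Finset.mul_sum, e1, e2] at e3
  have e4 : mesh N ^ 2 * gradSum N (fun _ => 1) v
      = mesh N * ∑ i ∈ Finset.range (N + 1), (v (i + 1) - v i) ^ 2 := by
    simp only [gradSum, one_mul]; field_simp
  rw [e4]
  simp only [massSum, one_mul]
  have := mul_le_mul_of_nonneg_left e3 hh.le
  linarith

/-- Absorption of the source and terminal terms for a large weight parameter `s`. -/
theorem le_of_weighted_estimates {r K M s c ε E₀ B G I S Φ b : ℝ} (hs : 0 < s) (hε : 0 < ε)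
    (hc : 0 ≤ c) (hcε : c + 4 * ε ≤ 1) (hI : 0 ≤ I) (hΦ : 0 ≤ Φ)
    (kS : S ≤ 2 * K ^ 2 * Φ + 2 * M * I) (hM : M ≤ s ^ 2 * ε ^ 2)
    (kC : 2 * ε * s * I ≤ 2 * B + G + 1 / (2 * (ε * s)) * S)
    (kT : E₀ ≤ B + (c * s + s + s) * I + 1 / (2 * s) * S) (kR : r ^ 2 / 2 * Φ ≤ E₀)
    (kB : B ≤ b * Φ) (hb : (1 + 8 / ε) * b ≤ r ^ 2 / 8) (hK : K ^ 2 / s * (1 + 4 / ε ^ 2) ≤ r ^ 2 / 8) :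
    r ^ 2 / 4 * Φ ≤ 4 / ε * G := by
  have hε1 : ε ≤ 1 := by linarith
  have hc1 : c ≤ 1 := by linarith
  have kS' : S ≤ 2 * K ^ 2 * Φ + 2 * s ^ 2 * ε ^ 2 * I := by
    have := mul_le_mul_of_nonneg_right hM hI
    linarith
  -- The potential part of S uses up half of 2εsI.
  have kC' : ε * s * I ≤ 2 * B + G + K ^ 2 * Φ / (ε * s) := by
    have e1 := mul_le_mul_of_nonneg_left kS' (by positivity : 0 ≤ 1 / (2 * (ε * s)))
    have e2 : 1 / (2 * (ε * s)) * (2 * K ^ 2 * Φ + 2 * s ^ 2 * ε ^ 2 * I)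
        = K ^ 2 * Φ / (ε * s) + ε * s * I := by field_simp
    linarith
  -- At most 3s from the energy estimate, since c ≤ 1, and one more s from S, since ε ≤ 1.
  have kT' : E₀ ≤ B + 4 * s * I + K ^ 2 / s * Φ := by
    have e1 := mul_le_mul_of_nonneg_left kS' (by positivity : 0 ≤ 1 / (2 * s))
    have e2 : 1 / (2 * s) * (2 * K ^ 2 * Φ + 2 * s ^ 2 * ε ^ 2 * I)
        = K ^ 2 / s * Φ + s * I * ε ^ 2 := by field_simp
    have e3 : s * I * ε ^ 2 ≤ s * I * 1 :=
      mul_le_mul_of_nonneg_left (pow_le_one₀ hε.le hε1) (by positivity)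
    have e4 : c * (s * I) ≤ 1 * (s * I) := mul_le_mul_of_nonneg_right hc1 (by positivity)
    linarith
  have kI : 4 * s * I ≤ 4 / ε * (2 * B + G + K ^ 2 * Φ / (ε * s)) := by
    have e : 4 * s * I = 4 / ε * (ε * s * I) := by field_simp
    rw [e]
    exact mul_le_mul_of_nonneg_left kC' (by positivity)
  have e : 4 / ε * (2 * B + G + K ^ 2 * Φ / (ε * s))
      = 8 / ε * B + 4 / ε * G + K ^ 2 / s * (4 / ε ^ 2) * Φ := by field_simp; ring
  have kB' : (1 + 8 / ε) * B ≤ r ^ 2 / 8 * Φ := by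
    calc _ ≤ (1 + 8 / ε) * (b * Φ) := mul_le_mul_of_nonneg_left kB (by positivity)
      _ = (1 + 8 / ε) * b * Φ := by ring
      _ ≤ _ := mul_le_mul_of_nonneg_right hb hΦ
  have kK := mul_le_mul_of_nonneg_right hK hΦ
  linarith

/-! ### Observability on fine and on coarse meshes -/

namespace IsDifferentiatedWave

variable {T m K : ℝ} {N : ℕ} {q f R₀ : ℕ → ℝ} {R' z p : ℝ → ℕ → ℝ}
  (W : IsDifferentiatedWave T m K N q f R₀ R' z p)
include W

theorem flux_div_integrable :
    IntervalIntegrable (fun t => (z t (N + 1) - z t N) ^ 2 / (2 * mesh N ^ 2)) volume 0 T :=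
  ContinuousOn.intervalIntegrable
    (by rw [uIcc_of_le W.time_pos.le]; exact W.continuousOn_flux_sq.div_const _)

theorem tychonoff_integrable (θ : ℕ → ℝ) :
    IntervalIntegrable (fun t => mesh N ^ 2 * gradSum N θ (p t)) volume 0 T :=
  ContinuousOn.intervalIntegrable
    (by rw [uIcc_of_le W.time_pos.le]
        exact continuousOn_const.mul (W.continuousOn_gradSum_velocity θ))

/-- The weighted argument with θ_i = (1 + sh)^i, which lies between 1 and e^s on the grid: the lower
bound lets the weight be dropped on f, the upper one on the observed quantities. -/
theorem massSum_le_of_small_mesh {r κ s c ε : ℝ} (hr : 0 ≤ r)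
    (hR : ∀ i < N, r ≤ |R₀ (i + 1)|) (hκ : ∀ i < N, R₀ (i + 1) ^ 2 ≤ κ)
    (hs : 0 < s) (hε : 0 < ε) (hc : 0 ≤ c) (hcε : c + 4 * ε ≤ 1) (hsh : s * mesh N ≤ ε)
    (hms : 2 * m ^ 2 * T ^ 2 ≤ s ^ 2 * ε ^ 2)
    (h1s : (1 + 8 / ε) * (Real.exp (-(s * (c * T - 1))) * forwardConst T m K κ) ≤ r ^ 2 / 8)
    (h2s : K ^ 2 / s * (1 + 4 / ε ^ 2) ≤ r ^ 2 / 8) :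
    r ^ 2 / 4 * massSum N (fun _ => 1) f
      ≤ 4 / ε * (Real.exp s * ((∫ t in (0 : ℝ)..T, (z t (N + 1) - z t N) ^ 2 / (2 * mesh N ^ 2))
        + s / 4 * ∫ t in (0 : ℝ)..T, mesh N ^ 2 * gradSum N (fun _ => 1) (p t))) := by
  have h0 := W.time_pos.le
  have hh := mesh_pos N
  have hone : ∀ _ : ℕ, (0 : ℝ) ≤ 1 := fun _ => zero_le_one
  set θ : ℕ → ℝ := fun i => (1 + s * mesh N) ^ i with hθdef
  have hη : 0 ≤ s * mesh N := by positivity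
  have hθ : ∀ i, 0 ≤ θ i := fun i => by positivity
  have hθ1 : ∀ i, 1 ≤ θ i := fun i => one_le_pow₀ (by linarith)
  have hstep : ∀ i, θ (i + 1) = (1 + s * mesh N) * θ i := fun i => pow_succ' _ _
  have hmono : ∀ i, θ i ≤ θ (i + 1) := fun i => by
    rw [hstep]; nlinarith [mul_nonneg hη (hθ i)]
  have hθe : ∀ i ≤ N + 1, θ i ≤ Real.exp s := fun i hi => by
    calc θ i ≤ (1 + s * mesh N) ^ (N + 1) := pow_le_pow_right₀ (by linarith) hi
      _ ≤ Real.exp (s * mesh N) ^ (N + 1) := by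
        gcongr; linarith [Real.add_one_le_exp (s * mesh N)]
      _ = Real.exp s := by
        rw [← Real.exp_nat_mul]
        congr 1
        have := mesh_mul N
        push_cast
        linear_combination s * this
  have hcs : 0 ≤ c * s := mul_nonneg hc hs.le
  set I := ∫ t in (0 : ℝ)..T, Real.exp (-(c * s) * t) * energy N θ (z t) (p t) with hI
  have hI0 : 0 ≤ I := intervalIntegral.integral_nonneg h0 fun t _ =>
    mul_nonneg (Real.exp_pos _).le (energy_nonneg hθ _ _)
  set Φ := massSum N θ f with hΦ
  have hΦ1 : massSum N (fun _ => 1) f ≤ Φ := massSum_mono_weight (fun i _ => hθ1 _) f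
  have hΦ0 : 0 ≤ Φ := massSum_nonneg hθ f
  set B := Real.exp (-(c * s) * T) * energy N θ (z T) (p T) with hB
  set G := ∫ t in (0 : ℝ)..T, Real.exp (-(c * s) * t)
          * (θ (N + 1) * (z t (N + 1) - z t N) ^ 2 / (2 * mesh N ^ 2)
            + s / 4 * (mesh N ^ 2 * gradSum N θ (p t))) with hG
  set S := ∫ t in (0 : ℝ)..T, Real.exp (-(c * s) * t) * massSum N θ (force q f R' z t) with hS
  have kS : S ≤ 2 * K ^ 2 * Φ + 4 * m ^ 2 * T ^ 2 * I := W.integral_weight_mul_force_le hcs hθ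
  have kC := W.integral_weight_mul_energy_le hs hε hc hcε hsh hθ hstep
  rw [← hI, ← hB, ← hG, ← hS] at kC
  have kT := (W.energy_estimates hs hs.le hθ hmono
    (fun i => by rw [hstep]; exact le_of_eq (by ring)) (c * s)).1
  rw [← hI, ← hB, ← hS] at kT
  have kR := W.le_energy_initial hθ hr hR
  rw [← hΦ] at kR
  -- The spatial weight costs e^s and the time weight gains e^{-csT}; the product is small for large
  -- s when cT > 1.
  have kB : B ≤ Real.exp (-(s * (c * T - 1))) * forwardConst T m K κ * Φ := by
    have b1 : energy N θ (z T) (p T) ≤ Real.exp s * energy N (fun _ => 1) (z T) (p T) := by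
      have e1 := massSum_mono_weight (N := N) (θ := θ) (ϑ := fun _ => Real.exp s)
        (fun i hi => hθe _ (by omega)) (p T)
      have e2 := gradSum_mono_weight (N := N) (θ := θ) (ϑ := fun _ => Real.exp s)
        (fun i hi => hθe _ (by omega)) (z T)
      rw [massSum_mul_weight] at e1
      rw [gradSum_mul_weight] at e2
      unfold energy
      linarith
    have b2 := W.energy_add_integral_energy_le hκ
    have b3 : 0 ≤ ∫ t in (0 : ℝ)..T, energy N (fun _ => 1) (z t) (p t) :=
      intervalIntegral.integral_nonneg h0 fun t _ => energy_nonneg hone _ _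
    have hF0 : 0 ≤ forwardConst T m K κ * massSum N (fun _ => 1) f :=
      (add_nonneg (energy_nonneg hone _ _) b3).trans b2
    have hF : forwardConst T m K κ * massSum N (fun _ => 1) f ≤ forwardConst T m K κ * Φ := by
      -- Without interior nodes κ may be negative, but then both sides vanish.
      rcases Nat.eq_zero_or_pos N with rfl | hN
      · simp [hΦ, massSum]
      · have : 0 ≤ κ := (sq_nonneg _).trans (hκ 0 hN)
        have : 0 ≤ forwardConst T m K κ := by unfold forwardConst; positivity
        gcongr
    have e : Real.exp (-(c * s) * T) * Real.exp s = Real.exp (-(s * (c * T - 1))) := by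
      rw [← Real.exp_add]; congr 1; ring
    calc B ≤ Real.exp (-(c * s) * T) * (Real.exp s * energy N (fun _ => 1) (z T) (p T)) := by
          rw [hB]; gcongr
      _ = Real.exp (-(s * (c * T - 1))) * energy N (fun _ => 1) (z T) (p T) := by
          rw [← mul_assoc, e]
      _ ≤ Real.exp (-(s * (c * T - 1))) * (forwardConst T m K κ * Φ) := by
          gcongr; linarith
      _ = _ := by ring
  have kG : G ≤ Real.exp s * ((∫ t in (0 : ℝ)..T, (z t (N + 1) - z t N) ^ 2 / (2 * mesh N ^ 2))
        + s / 4 * ∫ t in (0 : ℝ)..T, mesh N ^ 2 * gradSum N (fun _ => 1) (p t)) := by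
    have i1 := W.flux_div_integrable
    have i2 := (W.tychonoff_integrable (fun _ => 1)).const_mul (s / 4)
    rw [← intervalIntegral.integral_const_mul (s / 4), ← intervalIntegral.integral_add i1 i2,
      ← intervalIntegral.integral_const_mul]
    refine intervalIntegral.integral_mono_on h0 (W.weight_mul_integrable
      (((W.continuousOn_flux_sq.const_mul (θ (N + 1))).div_const (2 * mesh N ^ 2)).add
      (((W.continuousOn_gradSum_velocity θ).const_mul (mesh N ^ 2)).const_mul
      (s / 4))) (c * s)) ((i1.add i2).const_mul _) fun t ht => ?_
    have g1 : gradSum N θ (p t) ≤ Real.exp s * gradSum N (fun _ => 1) (p t) := by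
      rw [← gradSum_mul_weight]
      exact gradSum_mono_weight (fun i hi => hθe i (by omega)) _
    have g2 : θ (N + 1) * (z t (N + 1) - z t N) ^ 2 / (2 * mesh N ^ 2)
        ≤ Real.exp s * ((z t (N + 1) - z t N) ^ 2 / (2 * mesh N ^ 2)) := by
      rw [mul_div_assoc]
      exact mul_le_mul_of_nonneg_right (hθe _ le_rfl) (by positivity)
    have g3 : Real.exp (-(c * s) * t) ≤ 1 := Real.exp_le_one_iff.2 (by nlinarith [ht.1])
    have g4 := gradSum_nonneg (N := N) hθ (p t)
    have g5 := hθ (N + 1)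
    calc _ ≤ 1 * (θ (N + 1) * (z t (N + 1) - z t N) ^ 2 / (2 * mesh N ^ 2)
            + s / 4 * (mesh N ^ 2 * gradSum N θ (p t))) := by gcongr
      _ ≤ 1 * (Real.exp s * ((z t (N + 1) - z t N) ^ 2 / (2 * mesh N ^ 2))
            + s / 4 * (mesh N ^ 2 * (Real.exp s * gradSum N (fun _ => 1) (p t)))) := by gcongr
      _ = _ := by ring
  have key := le_of_weighted_estimates hs hε hc hcε hI0 hΦ0 (by linarith) hms kC kT kR kB h1s h2s
  calc r ^ 2 / 4 * massSum N (fun _ => 1) f ≤ r ^ 2 / 4 * Φ := by gcongr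
    _ ≤ 4 / ε * G := key
    _ ≤ _ := by gcongr

/-- Poincaré controls p by its differences; z is the time integral of p, and the inverse inequality
controls the gradient of z by z. The constant degenerates as h → 0. -/
theorem integral_energy_le_tychonoff :
    ∫ t in (0 : ℝ)..T, energy N (fun _ => 1) (z t) (p t)
      ≤ (1 + 4 * T ^ 2 / mesh N ^ 2) / (2 * mesh N ^ 2) *
        ∫ t in (0 : ℝ)..T, mesh N ^ 2 * gradSum N (fun _ => 1) (p t) := by
  have h0 := W.time_pos.le
  have hh := mesh_pos N
  have ii : ∀ {g : ℝ → ℝ}, ContinuousOn g (Icc 0 T) → IntervalIntegrable g volume 0 T :=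
    fun hg => ContinuousOn.intervalIntegrable (by rwa [uIcc_of_le h0])
  have hzc : ∀ i < N, ContinuousOn (fun t => z t (i + 1) ^ 2) (Icc 0 T) := fun i hi =>
    (W.continuousOn_position (by omega)).pow 2
  have hpc : ∀ i < N, ContinuousOn (fun t => p t (i + 1) ^ 2) (Icc 0 T) := fun i hi =>
    (W.continuousOn_velocity (by omega)).pow 2
  have hMz : ContinuousOn (fun t => massSum N (fun _ => 1) (z t)) (Icc 0 T) :=
    continuousOn_const.mul (continuousOn_finsetSum _ fun i hi =>
      continuousOn_const.mul (hzc i (Finset.mem_range.1 hi)))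
  have hMp := W.continuousOn_massSum (fun _ => 1)
  have h1 : ∫ t in (0 : ℝ)..T, massSum N (fun _ => 1) (z t)
      ≤ T ^ 2 * ∫ t in (0 : ℝ)..T, massSum N (fun _ => 1) (p t) := by
    have e1 := integral_weight_mul_massSum (T := T) (N := N) (w := fun _ => 1) (θ := fun _ => 1) (v := z)
      (fun i hi => ii (continuousOn_const.mul (hzc i hi)))
    have e2 := integral_weight_mul_massSum (T := T) (N := N) (w := fun _ => 1) (θ := fun _ => 1) (v := p)
      (fun i hi => ii (continuousOn_const.mul (hpc i hi)))
    simp only [one_mul] at e1 e2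
    rw [e1, e2, mul_left_comm, Finset.mul_sum _ _ (T ^ 2)]
    refine mul_le_mul_of_nonneg_left (Finset.sum_le_sum fun i hi => ?_) hh.le
    have := Finset.mem_range.1 hi
    have := W.integral_weight_mul_position_sq_le (lam := 0) le_rfl (j := i + 1) (by omega)
    simpa using this
  have h2 : ∫ t in (0 : ℝ)..T, energy N (fun _ => 1) (z t) (p t)
      ≤ ∫ t in (0 : ℝ)..T, (1 / 2 * massSum N (fun _ => 1) (p t)
        + 2 / mesh N ^ 2 * massSum N (fun _ => 1) (z t)) := by
    refine intervalIntegral.integral_mono_on h0 (ii (W.continuousOn_energy _))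
      (((ii hMp).const_mul _).add ((ii hMz).const_mul _)) fun t ht => ?_
    have := gradSum_le_massSum (W.position_left t ht) (W.position_right t ht)
    have e : gradSum N (fun _ => 1) (z t) ≤ 4 / mesh N ^ 2 * massSum N (fun _ => 1) (z t) := by
      rw [div_mul_eq_mul_div, le_div_iff₀ (by positivity)]
      linarith
    have e' : 4 / mesh N ^ 2 * massSum N (fun _ => 1) (z t)
        = 2 * (2 / mesh N ^ 2 * massSum N (fun _ => 1) (z t)) := by ring
    unfold energy
    linarith
  rw [intervalIntegral.integral_add ((ii hMp).const_mul _) ((ii hMz).const_mul _),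
    intervalIntegral.integral_const_mul, intervalIntegral.integral_const_mul] at h2
  have h3 : ∫ t in (0 : ℝ)..T, massSum N (fun _ => 1) (p t)
      ≤ 1 / mesh N ^ 2 * ∫ t in (0 : ℝ)..T, mesh N ^ 2 * gradSum N (fun _ => 1) (p t) := by
    rw [← intervalIntegral.integral_const_mul]
    refine intervalIntegral.integral_mono_on h0 (ii hMp)
      ((W.tychonoff_integrable (fun _ => 1)).const_mul _) fun t ht => ?_
    have := massSum_le_gradSum (N := N) (W.velocity_left t ht)
    have e : 1 / mesh N ^ 2 * (mesh N ^ 2 * gradSum N (fun _ => 1) (p t))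
        = gradSum N (fun _ => 1) (p t) := by field_simp
    rwa [e]
  calc _ ≤ 1 / 2 * (∫ t in (0 : ℝ)..T, massSum N (fun _ => 1) (p t))
        + 2 / mesh N ^ 2 * (T ^ 2 * ∫ t in (0 : ℝ)..T, massSum N (fun _ => 1) (p t)) :=
        h2.trans (by gcongr)
    _ = (1 / 2 + 2 / mesh N ^ 2 * T ^ 2) * ∫ t in (0 : ℝ)..T, massSum N (fun _ => 1) (p t) := by ring
    _ ≤ (1 / 2 + 2 / mesh N ^ 2 * T ^ 2) * (1 / mesh N ^ 2 *
        ∫ t in (0 : ℝ)..T, mesh N ^ 2 * gradSum N (fun _ => 1) (p t)) := by gcongr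
    _ = _ := by field_simp; ring

/-- No multiplier is needed when h ≥ h₀: a large time decay λ makes the terminal and source terms
small, and the integrated energy left over is bounded by the Tychonoff term. -/
theorem massSum_le_of_large_mesh {r κ lam : ℝ} (hr : 0 ≤ r)
    (hR : ∀ i < N, r ≤ |R₀ (i + 1)|) (hκ : ∀ i < N, R₀ (i + 1) ^ 2 ≤ κ) (hlam : 0 < lam)
    (h1 : Real.exp (-lam * T) * forwardConst T m K κ ≤ r ^ 2 / 8) (h2 : K ^ 2 / lam ≤ r ^ 2 / 8)
    {h₀ : ℝ} (hh₀ : 0 < h₀) (hmesh : h₀ ≤ mesh N) :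
    r ^ 2 / 4 * massSum N (fun _ => 1) f
      ≤ (2 * lam + 2 * m ^ 2 * T ^ 2 / lam) * ((1 + 4 * T ^ 2 / h₀ ^ 2) / (2 * h₀ ^ 2)) *
        ∫ t in (0 : ℝ)..T, mesh N ^ 2 * gradSum N (fun _ => 1) (p t) := by
  have h0 := W.time_pos.le
  have hh := mesh_pos N
  have hone : ∀ _ : ℕ, (0 : ℝ) ≤ 1 := fun _ => zero_le_one
  set I := ∫ t in (0 : ℝ)..T, Real.exp (-lam * t) * energy N (fun _ => 1) (z t) (p t) with hI
  set J := ∫ t in (0 : ℝ)..T, energy N (fun _ => 1) (z t) (p t) with hJ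
  set Φ := massSum N (fun _ => 1) f with hΦ
  have hΦ0 : 0 ≤ Φ := massSum_nonneg hone f
  have hJ0 : 0 ≤ J := intervalIntegral.integral_nonneg h0 fun t _ => energy_nonneg hone _ _
  have hIJ : I ≤ J := by
    refine intervalIntegral.integral_mono_on h0 (W.weight_mul_integrable (W.continuousOn_energy _) lam)
      (ContinuousOn.intervalIntegrable (by rw [uIcc_of_le h0]; exact W.continuousOn_energy _))
      fun t ht => ?_
    exact mul_le_of_le_one_left (energy_nonneg hone _ _)
      (Real.exp_le_one_iff.2 (by nlinarith [ht.1]))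
  have k1 := (W.energy_estimates (θ := fun _ => 1) (σ := 0) hlam le_rfl hone (fun _ => le_rfl)
    (fun _ => by simp) lam).1
  have k2 := W.integral_weight_mul_force_le hlam.le hone
  have k3 := W.le_energy_initial hone hr hR
  have k4 := W.energy_add_integral_energy_le hκ
  rw [← hI] at k1 k2
  rw [← hJ] at k4
  rw [← hΦ] at k2 k3 k4
  have k5 : 1 / (2 * lam) * (∫ t in (0 : ℝ)..T,
      Real.exp (-lam * t) * massSum N (fun _ => 1) (force q f R' z t))
      ≤ K ^ 2 / lam * Φ + 2 * m ^ 2 * T ^ 2 / lam * I := by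
    calc _ ≤ 1 / (2 * lam) * (2 * K ^ 2 * Φ + 4 * m ^ 2 * T ^ 2 * I) := by gcongr
      _ = _ := by field_simp; ring
  have k6 : Real.exp (-lam * T) * energy N (fun _ => 1) (z T) (p T) ≤ r ^ 2 / 8 * Φ := by
    calc _ ≤ Real.exp (-lam * T) * (forwardConst T m K κ * Φ) := by gcongr; linarith
      _ = Real.exp (-lam * T) * forwardConst T m K κ * Φ := by ring
      _ ≤ _ := by gcongr
  have k7 : K ^ 2 / lam * Φ ≤ r ^ 2 / 8 * Φ := by gcongr
  have k8 : (2 * lam + 2 * m ^ 2 * T ^ 2 / lam) * I ≤ (2 * lam + 2 * m ^ 2 * T ^ 2 / lam) * J := by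
    gcongr
  have hTy0 : 0 ≤ ∫ t in (0 : ℝ)..T, mesh N ^ 2 * gradSum N (fun _ => 1) (p t) :=
    intervalIntegral.integral_nonneg h0 fun t _ => mul_nonneg (sq_nonneg _) (gradSum_nonneg hone _)
  have k9 : J ≤ (1 + 4 * T ^ 2 / h₀ ^ 2) / (2 * h₀ ^ 2) *
        ∫ t in (0 : ℝ)..T, mesh N ^ 2 * gradSum N (fun _ => 1) (p t) :=
    W.integral_energy_le_tychonoff.trans (by gcongr)
  have k10 := mul_le_mul_of_nonneg_left k9 (by positivity : 0 ≤ 2 * lam + 2 * m ^ 2 * T ^ 2 / lam)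
  linarith

end IsDifferentiatedWave

/-- Uniform observability of the source. -/
theorem exists_observability_const {T m K r κ : ℝ} (hT : 1 < T) (hr : 0 < r) :
    ∃ C : ℝ, 0 ≤ C ∧ ∀ (N : ℕ) (q f R₀ : ℕ → ℝ) (R' z p : ℝ → ℕ → ℝ),
      IsDifferentiatedWave T m K N q f R₀ R' z p → (∀ i < N, r ≤ |R₀ (i + 1)|) →
      (∀ i < N, R₀ (i + 1) ^ 2 ≤ κ) →
      massSum N (fun _ => 1) f
        ≤ C * ((∫ t in (0 : ℝ)..T, (z t (N + 1) - z t N) ^ 2 / (2 * mesh N ^ 2))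
          + ∫ t in (0 : ℝ)..T, mesh N ^ 2 * gradSum N (fun _ => 1) (p t)) := by
  have hT0 : 0 < T := by linarith
  obtain ⟨c, ε, hc, hε, hcε, hcT⟩ : ∃ c ε : ℝ, 0 ≤ c ∧ 0 < ε ∧ c + 4 * ε ≤ 1 ∧ 1 < c * T := by
    have h1 : 1 / T < 1 := by rw [div_lt_one hT0]; exact hT
    -- c is the midpoint of 1/T and 1, so cT = (T + 1)/2 > 1, and ε gives equality in c + 4ε ≤ 1.
    refine ⟨(1 + 1 / T) / 2, (1 - 1 / T) / 8, by positivity, by linarith, by linarith, ?_⟩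
    have : (1 + 1 / T) / 2 * T = (T + 1) / 2 := by field_simp
    rw [this]; linarith
  have hinv : ∀ b : ℝ, Filter.Tendsto (fun s : ℝ => K ^ 2 / s * b) Filter.atTop (nhds 0) := fun b => by
    have := (Filter.Tendsto.const_div_atTop Filter.tendsto_id (K ^ 2)).mul_const b
    simpa using this
  have hexp : ∀ a b d : ℝ, 0 < a → Filter.Tendsto (fun s : ℝ => d * (Real.exp (-(s * a)) * b))
      Filter.atTop (nhds 0) := fun a b d ha => by
    have h1 : Filter.Tendsto (fun s : ℝ => Real.exp (-(s * a))) Filter.atTop (nhds 0) :=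
      Real.tendsto_exp_neg_atTop_nhds_zero.comp (Filter.tendsto_id.atTop_mul_const ha)
    have := (h1.mul_const b).const_mul d
    simpa using this
  have hr8 : (0 : ℝ) < r ^ 2 / 8 := by positivity
  obtain ⟨s, hs, hms, h1s, h2s⟩ : ∃ s : ℝ, 0 < s ∧ 2 * m ^ 2 * T ^ 2 ≤ s ^ 2 * ε ^ 2 ∧
      (1 + 8 / ε) * (Real.exp (-(s * (c * T - 1))) * IsDifferentiatedWave.forwardConst T m K κ)
        ≤ r ^ 2 / 8 ∧ K ^ 2 / s * (1 + 4 / ε ^ 2) ≤ r ^ 2 / 8 := by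
    have e1 : Filter.Tendsto (fun s : ℝ => s ^ 2 * ε ^ 2) Filter.atTop Filter.atTop :=
      (Filter.tendsto_pow_atTop two_ne_zero).atTop_mul_const (by positivity)
    exact ((Filter.eventually_gt_atTop 0).and ((e1.eventually_ge_atTop _).and
      (((hexp _ _ _ (by linarith)).eventually_le_const hr8).and
        ((hinv _).eventually_le_const hr8)))).exists
  obtain ⟨lam, hlam, h1l, h2l⟩ : ∃ lam : ℝ, 0 < lam ∧
      Real.exp (-lam * T) * IsDifferentiatedWave.forwardConst T m K κ ≤ r ^ 2 / 8 ∧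
      K ^ 2 / lam ≤ r ^ 2 / 8 := by
    obtain ⟨l, h1, h2, h3⟩ := ((Filter.eventually_gt_atTop 0).and
      (((hexp T (IsDifferentiatedWave.forwardConst T m K κ) 1 hT0).eventually_le_const hr8).and
        ((hinv 1).eventually_le_const hr8))).exists
    exact ⟨l, h1, by simpa [neg_mul] using h2, by simpa using h3⟩
  -- The threshold separating the two regimes: h ≤ h₀ is exactly sh ≤ ε. It depends on s, which is
  -- fixed before any mesh.
  set h₀ := ε / s with hh₀
  have hh₀pos : 0 < h₀ := by positivity
  set A := 4 / ε * Real.exp s with hA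
  set B := (2 * lam + 2 * m ^ 2 * T ^ 2 / lam) * ((1 + 4 * T ^ 2 / h₀ ^ 2) / (2 * h₀ ^ 2)) with hB
  have hA0 : 0 ≤ A := by positivity
  have hB0 : 0 ≤ B := by positivity
  refine ⟨4 / r ^ 2 * (A + A * (s / 4) + B), by positivity, fun N q f R₀ R' z p W hR hκ => ?_⟩
  have hF0 : 0 ≤ ∫ t in (0 : ℝ)..T, (z t (N + 1) - z t N) ^ 2 / (2 * mesh N ^ 2) :=
    intervalIntegral.integral_nonneg hT0.le fun t _ => by positivity
  have hTy0 : 0 ≤ ∫ t in (0 : ℝ)..T, mesh N ^ 2 * gradSum N (fun _ => 1) (p t) :=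
    intervalIntegral.integral_nonneg hT0.le fun t _ =>
      mul_nonneg (sq_nonneg _) (gradSum_nonneg (fun _ => zero_le_one) _)
  set X := ∫ t in (0 : ℝ)..T, (z t (N + 1) - z t N) ^ 2 / (2 * mesh N ^ 2)
  set Y := ∫ t in (0 : ℝ)..T, mesh N ^ 2 * gradSum N (fun _ => 1) (p t)
  have key : r ^ 2 / 4 * massSum N (fun _ => 1) f ≤ (A + A * (s / 4) + B) * (X + Y) := by
    have p1 := mul_nonneg hA0 hF0
    have p2 := mul_nonneg hA0 hTy0
    have p3 : 0 ≤ A * (s / 4) * X := by positivity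
    have p4 : 0 ≤ A * (s / 4) * Y := by positivity
    have p5 := mul_nonneg hB0 hF0
    have p6 := mul_nonneg hB0 hTy0
    rcases le_total (mesh N) h₀ with h | h
    · have hsh : s * mesh N ≤ ε := by
        rw [hh₀, le_div_iff₀ hs] at h; linarith
      have := W.massSum_le_of_small_mesh hr.le hR hκ hs hε hc hcε hsh hms h1s h2s
      have e : 4 / ε * (Real.exp s * (X + s / 4 * Y)) = A * X + A * (s / 4) * Y := by
        rw [hA]; ring
      linarith
    · have := W.massSum_le_of_large_mesh hr.le hR hκ hlam h1l h2l hh₀pos h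
      linarith
  calc massSum N (fun _ => 1) f = 4 / r ^ 2 * (r ^ 2 / 4 * massSum N (fun _ => 1) f) := by field_simp
    _ ≤ 4 / r ^ 2 * ((A + A * (s / 4) + B) * (X + Y)) := by gcongr
    _ = _ := by ring

/-! ### Consequences of the H¹ bound on R -/

theorem le_linfNorm {N : ℕ} (v : ℕ → ℝ) {j : ℕ} (hj : j ∈ Finset.Icc 1 N) : |v j| ≤ linfNorm N v :=
  le_ciSup (f := fun j : Finset.Icc 1 N => |v j|) (Set.finite_range _).bddAbove ⟨j, hj⟩

theorem linfNorm_sq_le {N : ℕ} (v : ℕ → ℝ) : linfNorm N v ^ 2 ≤ ∑ j ∈ Finset.Icc 1 N, v j ^ 2 := by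
  rcases isEmpty_or_nonempty (Finset.Icc 1 N) with h | h
  · rw [linfNorm, Real.iSup_of_isEmpty, zero_pow two_ne_zero]
    exact Finset.sum_nonneg fun _ _ => sq_nonneg _
  · obtain ⟨j, hj⟩ := exists_eq_ciSup_of_finite (f := fun j : Finset.Icc 1 N => |v j|)
    rw [linfNorm, ← hj, sq_abs]
    exact Finset.single_le_sum (f := fun j => v j ^ 2) (fun _ _ => sq_nonneg _) j.2

/-- Integrability is essential: the integral in `h1Norm` would be 0 by convention for a
non-integrable function, and the bound by K would then say nothing about the components. -/
theorem integrable_linfNorm_sq {N : ℕ} {μ : Measure ℝ} {v : ℝ → ℕ → ℝ}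
    (hv : ∀ j ∈ Finset.Icc 1 N, AEMeasurable (fun t => v t j) μ)
    (hv2 : ∀ j ∈ Finset.Icc 1 N, Integrable (fun t => v t j ^ 2) μ) :
    Integrable (fun t => linfNorm N (v t) ^ 2) μ := by
  have hm : AEMeasurable (fun t => linfNorm N (v t)) μ :=
    AEMeasurable.iSup fun j : Finset.Icc 1 N =>
      continuous_abs.measurable.comp_aemeasurable (hv j j.2)
  refine (integrable_finsetSum _ hv2).mono' (hm.pow_const 2).aestronglyMeasurable
    (Filter.Eventually.of_forall fun t => ?_)
  rw [Real.norm_of_nonneg (sq_nonneg _)]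
  exact linfNorm_sq_le _

namespace IsH1

variable {T K : ℝ} {N : ℕ} {R R' : ℝ → ℕ → ℝ} (hR : IsH1 T N R R')
include hR

theorem sq_integrableOn {j : ℕ} (hj : j ∈ Finset.Icc 1 N) :
    IntegrableOn (fun t => R t j ^ 2) (Ioo 0 T) :=
  ((hR.continuousOn j hj).pow 2).integrableOn_Icc.mono_set Ioo_subset_Icc_self

theorem deriv_sq_integrableOn {j : ℕ} (hj : j ∈ Finset.Icc 1 N) :
    IntegrableOn (fun t => R' t j ^ 2) (Ioo 0 T) :=
  (memLp_two_iff_integrable_sq (hR.memLp j hj).1).1 (hR.memLp j hj)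

theorem deriv_intervalIntegrable (hT : 0 ≤ T) {j : ℕ} (hj : j ∈ Finset.Icc 1 N) :
    IntervalIntegrable (fun t => R' t j) volume 0 T :=
  (intervalIntegrable_iff_integrableOn_Ioo_of_le hT).2 ((hR.memLp j hj).integrable (by norm_num))

theorem hasACDeriv (hT : 0 < T) {j : ℕ} (hj : j ∈ Finset.Icc 1 N) :
    HasACDeriv T (fun t => R t j) (fun t => R' t j) :=
  HasACDeriv.of_isWeakDeriv hT (hR.continuousOn j hj) (hR.deriv_intervalIntegrable hT.le hj)
    (hR.isWeakDeriv j hj)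

theorem integral_sq_add_le (hT : 0 ≤ T) (hK : 0 ≤ K) (hRK : h1Norm T N R R' ≤ K) {j : ℕ}
    (hj : j ∈ Finset.Icc 1 N) :
    (∫ t in (0 : ℝ)..T, R t j ^ 2) + ∫ t in (0 : ℝ)..T, R' t j ^ 2 ≤ K ^ 2 := by
  rw [h1Norm, Real.sqrt_le_left hK] at hRK
  refine le_trans ?_ hRK
  rw [intervalIntegral.integral_of_le hT, intervalIntegral.integral_of_le hT,
    integral_Ioc_eq_integral_Ioo, integral_Ioc_eq_integral_Ioo,
    ← integral_add (hR.sq_integrableOn hj) (hR.deriv_sq_integrableOn hj)]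
  refine integral_mono ((hR.sq_integrableOn hj).add (hR.deriv_sq_integrableOn hj))
    ((integrable_linfNorm_sq (fun i hi => ?_) fun i hi => hR.sq_integrableOn hi).add
      (integrable_linfNorm_sq (fun i hi => (hR.memLp i hi).1.aemeasurable)
        fun i hi => hR.deriv_sq_integrableOn hi)) fun t => ?_
  · exact ((hR.continuousOn i hi).mono Ioo_subset_Icc_self).aemeasurable measurableSet_Ioo
  · have h1 := pow_le_pow_left₀ (abs_nonneg _) (le_linfNorm (R t) hj) 2
    have h2 := pow_le_pow_left₀ (abs_nonneg _) (le_linfNorm (R' t) hj) 2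
    rw [sq_abs] at h1 h2
    exact add_le_add h1 h2

theorem integral_deriv_sq_le (hT : 0 ≤ T) (hK : 0 ≤ K) (hRK : h1Norm T N R R' ≤ K) {j : ℕ}
    (hj : j ∈ Finset.Icc 1 N) : ∫ t in (0 : ℝ)..T, R' t j ^ 2 ≤ K ^ 2 := by
  have h1 := hR.integral_sq_add_le hT hK hRK hj
  have h2 : 0 ≤ ∫ t in (0 : ℝ)..T, R t j ^ 2 :=
    intervalIntegral.integral_nonneg hT fun _ _ => sq_nonneg _
  linarith

/-- The trace at time `0` is bounded by the `H¹` norm. -/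
theorem initial_sq_le (hT : 0 < T) (hK : 0 ≤ K) (hRK : h1Norm T N R R' ≤ K) {j : ℕ}
    (hj : j ∈ Finset.Icc 1 N) : R 0 j ^ 2 ≤ (2 + 2 * T ^ 2) * K ^ 2 / T := by
  have hsq := (intervalIntegrable_iff_integrableOn_Ioo_of_le hT.le).2 (hR.sq_integrableOn hj)
  have hsq' := (intervalIntegrable_iff_integrableOn_Ioo_of_le hT.le).2 (hR.deriv_sq_integrableOn hj)
  have hAC := hR.hasACDeriv hT hj
  set D := ∫ t in (0 : ℝ)..T, R' t j ^ 2 with hD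
  have hD0 : 0 ≤ D := intervalIntegral.integral_nonneg hT.le fun _ _ => sq_nonneg _
  have hpt : ∀ t ∈ Icc 0 T, R 0 j ^ 2 ≤ 2 * R t j ^ 2 + 2 * (T * D) := by
    intro t ht
    have hsub : uIcc 0 t ⊆ uIcc 0 T := by
      rw [uIcc_of_le hT.le, uIcc_of_le ht.1]; exact Icc_subset_Icc_right ht.2
    have e1 := hAC.2 t ht
    have e2 := sq_integral_le ht.1 (hAC.intervalIntegrable_of_mem ht) (hsq'.mono_set hsub)
    have e3 : ∫ s in (0 : ℝ)..t, R' s j ^ 2 ≤ D :=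
      intervalIntegral.integral_mono_interval le_rfl ht.1 ht.2
        (Filter.Eventually.of_forall fun s => sq_nonneg _) hsq'
    have e4 : t * ∫ s in (0 : ℝ)..t, R' s j ^ 2 ≤ T * D :=
      (mul_le_mul_of_nonneg_left e3 ht.1).trans (mul_le_mul_of_nonneg_right ht.2 hD0)
    have e5 : R 0 j = R t j - ∫ s in (0 : ℝ)..t, R' s j := by linarith
    rw [e5]
    nlinarith [sq_nonneg (R t j + ∫ s in (0 : ℝ)..t, R' s j)]
  -- Averaging the pointwise bound over t in [0,T] trades R(t) for its L² norm.
  have h1 := intervalIntegral.integral_mono_on hT.le (by simp) ((hsq.const_mul 2).add (by simp)) hpt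
  rw [intervalIntegral.integral_add (hsq.const_mul 2) (by simp), intervalIntegral.integral_const_mul,
    intervalIntegral.integral_const, intervalIntegral.integral_const, smul_eq_mul, smul_eq_mul,
    sub_zero] at h1
  have h2 := hR.integral_sq_add_le hT.le hK hRK hj
  rw [← hD] at h2
  have h3 : 0 ≤ ∫ t in (0 : ℝ)..T, R t j ^ 2 :=
    intervalIntegral.integral_nonneg hT.le fun _ _ => sq_nonneg _
  rw [le_div_iff₀ hT]
  have h4 : T ^ 2 * D ≤ T ^ 2 * K ^ 2 := by gcongr; linarith
  linarith

end IsH1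

/-! ### From the semi-discrete wave equation to the differentiated system -/

theorem hasACDeriv_derivWithin {T : ℝ} (hT : 0 < T) {g : ℝ → ℝ} (hg : ContDiffOn ℝ 1 g (Icc 0 T)) :
    HasACDeriv T g (derivWithin g (Icc 0 T)) := by
  refine HasACDeriv.of_continuousOn hT.le hg.continuousOn
    (hg.continuousOn_derivWithin (uniqueDiffOn_Icc hT) le_rfl) fun t ht => ?_
  exact ((hg.differentiableOn one_ne_zero t (Ioo_subset_Icc_self ht)).hasDerivWithinAt).hasDerivAt
    (Icc_mem_nhds ht.1 ht.2)

namespace IsSolution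

variable {T m K : ℝ} {N : ℕ} {q f : ℕ → ℝ} {R R' u : ℝ → ℕ → ℝ} (hu : IsSolution T N q f R u)
include hu

theorem contDiffOn_dt (hT : 0 < T) {j : ℕ} (hj : j ≤ N + 1) :
    ContDiffOn ℝ 1 (fun t => dt T u t j) (Icc 0 T) :=
  (hu.contDiffOn j (by simpa using hj)).derivWithin (uniqueDiffOn_Icc hT) (by norm_num)

theorem eqOn_zero_left (hT : 0 < T) : EqOn (fun t => u t 0) (fun _ => 0) (Icc 0 T) := by
  have h : EqOn (fun t => u t 0) (fun _ => 0) (Ioo 0 T) := fun t ht => hu.left_boundary t ht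
  exact h.of_subset_closure (hu.contDiffOn 0 (by simp)).continuousOn continuousOn_const
    Ioo_subset_Icc_self (closure_Ioo hT.ne).ge

theorem eqOn_zero_right (hT : 0 < T) : EqOn (fun t => u t (N + 1)) (fun _ => 0) (Icc 0 T) := by
  have h : EqOn (fun t => u t (N + 1)) (fun _ => 0) (Ioo 0 T) := fun t ht => hu.right_boundary t ht
  exact h.of_subset_closure (hu.contDiffOn (N + 1) (by simp)).continuousOn continuousOn_const
    Ioo_subset_Icc_self (closure_Ioo hT.ne).ge

theorem position_initial (hT : 0 < T) {j : ℕ} (hj : j ≤ N + 1) : u 0 j = 0 := by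
  have h0 : (0 : ℝ) ∈ Icc 0 T := ⟨le_rfl, hT.le⟩
  rcases Nat.eq_zero_or_pos j with rfl | h
  · exact hu.eqOn_zero_left hT h0
  rcases hj.eq_or_lt with rfl | h'
  · exact hu.eqOn_zero_right hT h0
  · exact hu.initial_position j (Finset.mem_Icc.2 ⟨h, by omega⟩)

omit hu in
theorem derivWithin_eq_zero_of_eqOn {g : ℝ → ℝ} (h : EqOn g (fun _ => 0) (Icc 0 T)) :
    EqOn (derivWithin g (Icc 0 T)) (fun _ => 0) (Icc 0 T) := fun t ht => by
  rw [derivWithin_congr h (h ht)]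
  simp

theorem velocity_initial (hT : 0 < T) {j : ℕ} (hj : j ≤ N + 1) : dt T u 0 j = 0 := by
  have h0 : (0 : ℝ) ∈ Icc 0 T := ⟨le_rfl, hT.le⟩
  rcases Nat.eq_zero_or_pos j with rfl | h
  · exact derivWithin_eq_zero_of_eqOn (hu.eqOn_zero_left hT) h0
  rcases hj.eq_or_lt with rfl | h'
  · exact derivWithin_eq_zero_of_eqOn (hu.eqOn_zero_right hT) h0
  · exact hu.initial_velocity j (Finset.mem_Icc.2 ⟨h, by omega⟩)

/-- Both sides are continuous up to the endpoints. The value at t = 0 matters: it gives ∂_tt u(0) =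
f R(0). -/
theorem acceleration_eqOn (hT : 0 < T) (hR : IsH1 T N R R') {i : ℕ} (hi : i < N) :
    EqOn (fun t => dt T (dt T u) t (i + 1))
      (fun t => discreteLaplacian N (u t) (i + 1) - q (i + 1) * u t (i + 1)
        + f (i + 1) * R t (i + 1)) (Icc 0 T) := by
  have hmem : i + 1 ∈ Finset.Icc 1 N := Finset.mem_Icc.2 ⟨by omega, by omega⟩
  have hc : ∀ j ≤ N + 1, ContinuousOn (fun t => u t j) (Icc 0 T) := fun j hj =>
    (hu.contDiffOn j (by simpa using hj)).continuousOn
  have h : EqOn (fun t => dt T (dt T u) t (i + 1))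
      (fun t => discreteLaplacian N (u t) (i + 1) - q (i + 1) * u t (i + 1)
        + f (i + 1) * R t (i + 1)) (Ioo 0 T) := fun t ht => by
    have := hu.equation t ht (i + 1) hmem
    beta_reduce
    linarith
  refine h.of_subset_closure ((hu.contDiffOn_dt hT (by omega)).continuousOn_derivWithin
    (uniqueDiffOn_Icc hT) le_rfl) ?_ Ioo_subset_Icc_self (closure_Ioo hT.ne).ge
  refine ContinuousOn.add (ContinuousOn.sub (ContinuousOn.div_const (ContinuousOn.add
    (ContinuousOn.sub (hc _ (by omega)) (continuousOn_const.mul (hc _ (by omega))))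
    (hc _ (by omega))) _) (continuousOn_const.mul (hc _ (by omega))))
    (continuousOn_const.mul (hR.continuousOn _ hmem))

theorem isDifferentiatedWave (hT : 0 < T) (hK : 0 ≤ K) (hq : linfNorm N q ≤ m) (hR : IsH1 T N R R')
    (hRK : h1Norm T N R R' ≤ K) :
    IsDifferentiatedWave T m K N q f (R 0) R' (dt T u) (dt T (dt T u)) := by
  have hmem : ∀ i < N, i + 1 ∈ Finset.Icc 1 N := fun i hi => Finset.mem_Icc.2 ⟨by omega, by omega⟩
  have hAC : ∀ j ≤ N + 1, HasACDeriv T (fun t => u t j) (fun t => dt T u t j) := fun j hj =>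
    hasACDeriv_derivWithin hT ((hu.contDiffOn j (by simpa using hj)).of_le (by norm_num))
  have hleft := derivWithin_eq_zero_of_eqOn (hu.eqOn_zero_left hT)
  have hright := derivWithin_eq_zero_of_eqOn (hu.eqOn_zero_right hT)
  refine
    { time_pos := hT
      hasACDeriv_position := fun j hj => hasACDeriv_derivWithin hT (hu.contDiffOn_dt hT hj)
      hasACDeriv_velocity := fun i hi => ?_
      position_left := hleft
      position_right := hright
      velocity_left := derivWithin_eq_zero_of_eqOn hleft
      velocity_right := derivWithin_eq_zero_of_eqOn hright
      initial_position := fun j hj => hu.velocity_initial hT hj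
      initial_velocity := fun i hi => ?_
      potential_le := fun i hi => (le_linfNorm q (hmem i hi)).trans hq
      source_integrable := fun i hi => hR.deriv_intervalIntegrable hT.le (hmem i hi)
      source_sq_integrable := fun i hi =>
        (intervalIntegrable_iff_integrableOn_Ioo_of_le hT.le).2 (hR.deriv_sq_integrableOn (hmem i hi))
      source_le := fun i hi => hR.integral_deriv_sq_le hT.le hK hRK (hmem i hi) }
  -- The equation expresses the acceleration through u and R, which are absolutely continuous;
  -- differentiating this expression gives the equation for p.
  · have h := ((((hAC (i + 1 + 1) (by omega)).sub ((hAC (i + 1) (by omega)).const_mul 2)).add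
      (hAC i (by omega))).const_mul (mesh N ^ 2)⁻¹).sub ((hAC (i + 1) (by omega)).const_mul (q (i + 1)))
    refine (h.add ((hR.hasACDeriv hT (hmem i hi)).const_mul (f (i + 1)))).congr hT.le
      (fun t ht => ?_) fun t _ => ?_
    · refine (hu.acceleration_eqOn hT hR hi ht).trans ?_
      simp only [discreteLaplacian, Nat.add_sub_cancel]
      ring
    · simp only [discreteLaplacian, force, Nat.add_sub_cancel]
      ring
  · have := hu.acceleration_eqOn hT hR hi ⟨le_rfl, hT.le⟩
    beta_reduce at this
    rw [this]
    simp only [discreteLaplacian, Nat.add_sub_cancel]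
    rw [hu.position_initial hT (by omega : i + 1 + 1 ≤ N + 1),
      hu.position_initial hT (by omega : i + 1 ≤ N + 1), hu.position_initial hT (by omega : i ≤ N + 1)]
    ring

theorem fluxNorm_eq (hT : 0 < T) :
    fluxNorm T N u = Real.sqrt (2 * ∫ t in (0 : ℝ)..T,
      (dt T u t (N + 1) - dt T u t N) ^ 2 / (2 * mesh N ^ 2)) := by
  have hh := (mesh_pos N).ne'
  rw [fluxNorm, timeL2Norm, ← intervalIntegral.integral_const_mul,
    intervalIntegral.integral_of_le hT.le, integral_Ioc_eq_integral_Ioo]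
  congr 1
  refine setIntegral_congr_fun measurableSet_Ioo fun t ht => ?_
  have hd : ∀ j ≤ N + 1, DifferentiableWithinAt ℝ (fun t => u t j) (Icc 0 T) t := fun j hj =>
    (hu.contDiffOn j (by simpa using hj)).differentiableOn two_ne_zero t (Ioo_subset_Icc_self ht)
  have e : dt T (fun s => dMinus N (u s)) t (N + 1) = (dt T u t (N + 1) - dt T u t N) / mesh N := by
    simp only [dt, dMinus, Nat.add_sub_cancel]
    rw [derivWithin_div_const, derivWithin_fun_sub (hd _ le_rfl) (hd _ (by omega))]
  rw [e, sq_abs]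
  field_simp

omit hu in
theorem tychonoffNorm_eq (hT : 0 < T) :
    tychonoffNorm T N u = Real.sqrt (∫ t in (0 : ℝ)..T,
      mesh N ^ 2 * gradSum N (fun _ => 1) (dt T (dt T u) t)) := by
  have hh := mesh_pos N
  rw [tychonoffNorm, timeL2Norm, intervalIntegral.integral_of_le hT.le, integral_Ioc_eq_integral_Ioo]
  congr 1
  refine setIntegral_congr_fun measurableSet_Ioo fun t _ => ?_
  rw [sq_abs, l2NormLeft, Real.sq_sqrt
    (mul_nonneg hh.le (Finset.sum_nonneg fun _ _ => sq_nonneg _))]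
  have e : Finset.Icc 0 N = Finset.range (N + 1) := by
    ext; simp
  rw [e, gradSum, Finset.mul_sum, Finset.mul_sum, Finset.mul_sum]
  refine Finset.sum_congr rfl fun i _ => ?_
  rw [sq_abs, dPlus]
  field_simp

end IsSolution

theorem l2Norm_eq (N : ℕ) (f : ℕ → ℝ) : l2Norm N f = Real.sqrt (massSum N (fun _ => 1) f) := by
  have e : Finset.Icc 1 N = Finset.Ico 1 (N + 1) := by
    ext; simp
  simp only [l2Norm, massSum, sq_abs, one_mul]
  rw [e, Finset.sum_Ico_eq_sum_range, Nat.add_sub_cancel]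
  simp only [add_comm 1]

theorem IsDifferentiatedWave.integral_tychonoff_le {T m K κ : ℝ} {N : ℕ} {q f R₀ : ℕ → ℝ}
    {R' z p : ℝ → ℕ → ℝ} (W : IsDifferentiatedWave T m K N q f R₀ R' z p)
    (hκ : ∀ i < N, R₀ (i + 1) ^ 2 ≤ κ) :
    ∫ t in (0 : ℝ)..T, mesh N ^ 2 * gradSum N (fun _ => 1) (p t)
      ≤ 8 * forwardConst T m K κ * massSum N (fun _ => 1) f := by
  have h0 := W.time_pos.le
  have hone : ∀ _ : ℕ, (0 : ℝ) ≤ 1 := fun _ => zero_le_one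
  have h1 : ∫ t in (0 : ℝ)..T, mesh N ^ 2 * gradSum N (fun _ => 1) (p t)
      ≤ ∫ t in (0 : ℝ)..T, 8 * energy N (fun _ => 1) (z t) (p t) := by
    refine intervalIntegral.integral_mono_on h0 (W.tychonoff_integrable _)
      ((ContinuousOn.intervalIntegrable
        (by rw [uIcc_of_le h0]; exact W.continuousOn_energy _)).const_mul _) fun t ht => ?_
    have h2 := gradSum_le_massSum (W.velocity_left t ht) (W.velocity_right t ht)
    have h3 := gradSum_nonneg (N := N) hone (z t)
    unfold energy
    linarith
  rw [intervalIntegral.integral_const_mul 8] at h1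
  have h2 := W.energy_add_integral_energy_le hκ
  have h3 := energy_nonneg (N := N) hone (z T) (p T)
  linarith

end SemiDiscreteWave

/-! ### The two-sided estimate -/

open SemiDiscreteWave in
theorem theorem3p2 (m K r T : ℝ) (hm : 0 < m) (hK : 0 < K) (hr : 0 < r) (hT : 1 < T) :
    ∃ C : ℝ, 0 < C ∧
      ∀ (N : ℕ) (q f : ℕ → ℝ) (R R' u : ℝ → ℕ → ℝ),
        SemiDiscreteWave.linfNorm N q ≤ m →
        SemiDiscreteWave.IsH1 T N R R' →
        SemiDiscreteWave.h1Norm T N R R' ≤ K →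
        (∀ j ∈ Finset.Icc 1 N, r ≤ |R 0 j|) →
        SemiDiscreteWave.IsSolution T N q f R u →
        SemiDiscreteWave.fluxNorm T N u + SemiDiscreteWave.tychonoffNorm T N u
            ≤ C * SemiDiscreteWave.l2Norm N f ∧
        SemiDiscreteWave.l2Norm N f
            ≤ C * SemiDiscreteWave.fluxNorm T N u
              + C * SemiDiscreteWave.tychonoffNorm T N u := by
  have hT0 : 0 < T := by linarith
  -- The trace bound for |R(0)|², so that the constants depend only on T, m, K and r.
  set κ := (2 + 2 * T ^ 2) * K ^ 2 / T with hκdef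
  have hκ0 : 0 ≤ κ := by positivity
  obtain ⟨C, hC, hobs⟩ := exists_observability_const (m := m) (K := K) (κ := κ) hT hr
  have hF0 : 0 ≤ IsDifferentiatedWave.forwardConst T m K κ := by
    unfold IsDifferentiatedWave.forwardConst; positivity
  set A := 2 * ((4 + 2 * m ^ 2 * T ^ 2) * IsDifferentiatedWave.forwardConst T m K κ + K ^ 2) with hA
  set B := 8 * IsDifferentiatedWave.forwardConst T m K κ with hB
  have hA0 : 0 ≤ A := by positivity
  have hB0 : 0 ≤ B := by positivity
  refine ⟨Real.sqrt A + Real.sqrt B + Real.sqrt C + 1, by positivity, ?_⟩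
  intro N q f R R' u hq hR hRK hRr hu
  have W := hu.isDifferentiatedWave hT0 hK.le hq hR hRK
  have hmem : ∀ i < N, i + 1 ∈ Finset.Icc 1 N := fun i hi => Finset.mem_Icc.2 ⟨by omega, by omega⟩
  have hκ : ∀ i < N, R 0 (i + 1) ^ 2 ≤ κ := fun i hi => hR.initial_sq_le hT0 hK.le hRK (hmem i hi)
  have h1 := W.integral_flux_le hκ
  have h2 := W.integral_tychonoff_le hκ
  have h3 := hobs N q f (R 0) R' _ _ W (fun i hi => hRr _ (hmem i hi)) hκ
  rw [hu.fluxNorm_eq hT0, IsSolution.tychonoffNorm_eq hT0, l2Norm_eq]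
  set X := ∫ t in (0 : ℝ)..T, (dt T u t (N + 1) - dt T u t N) ^ 2 / (2 * mesh N ^ 2)
  set Y := ∫ t in (0 : ℝ)..T, mesh N ^ 2 * gradSum N (fun _ => 1) (dt T (dt T u) t)
  set Φ := massSum N (fun _ => 1) f
  have hX0 : 0 ≤ X := intervalIntegral.integral_nonneg hT0.le fun t _ => by positivity
  have hY0 : 0 ≤ Y := intervalIntegral.integral_nonneg hT0.le fun t _ =>
    mul_nonneg (sq_nonneg _) (gradSum_nonneg (fun _ => zero_le_one) _)
  have sA := Real.sqrt_nonneg A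
  have sB := Real.sqrt_nonneg B
  have sC := Real.sqrt_nonneg C
  have sΦ := Real.sqrt_nonneg Φ
  have sX := Real.sqrt_nonneg (2 * X)
  have sY := Real.sqrt_nonneg Y
  constructor
  · have e1 : Real.sqrt (2 * X) ≤ Real.sqrt A * Real.sqrt Φ := by
      rw [← Real.sqrt_mul hA0]
      exact Real.sqrt_le_sqrt (by rw [hA]; linarith)
    have e2 : Real.sqrt Y ≤ Real.sqrt B * Real.sqrt Φ := by
      rw [← Real.sqrt_mul hB0]
      exact Real.sqrt_le_sqrt h2
    have e3 := mul_nonneg sC sΦ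
    linarith
  · have e1 : Real.sqrt Φ ≤ Real.sqrt C * (Real.sqrt (2 * X) + Real.sqrt Y) := by
      refine Real.sqrt_le_iff.2 ⟨by positivity, h3.trans ?_⟩
      -- The square exceeds X + Y: the cross term is nonnegative and X ≤ 2X.
      rw [mul_pow, Real.sq_sqrt hC, add_sq, Real.sq_sqrt (by positivity), Real.sq_sqrt hY0]
      refine mul_le_mul_of_nonneg_left ?_ hC
      have := mul_nonneg sX sY
      linarith
    have e2 := mul_nonneg (add_nonneg sA sB) (add_nonneg sX sY)
    linarith
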